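/- **Setting.** Let $f=\frac1m\sum_{j=1}^m f_j$ with differentiable $f_j:\mathbb R^d\to\mathbb R$, let $\varepsilon>0$, and assume that * $f$ is $L_-$-smooth ($L_-\ge 0$) and $f\ge f^*$ for some $f^*\in\mathbb R$; * for some $L_+\ge0$, $\frac1m\sum_j\|\nabla f_j(x)-\nabla f_j(y)\|^2\le L_+^2\|x-y\|^2$ for all $x,y$; * for some $L_\pm\ge0$, $\frac1m\sum_j\|\nabla f_j(x)-\nabla f_j(y)-(\nabla f(x)-\nabla f(y))\|^2\le L_\pm^2\|x-y\|^2$ for all $x,y$. There are $n\ge1$ workers with time bounds $0\le\tau_1\le\dots\le\tau_n\le\infty$, and $m\ge n\log n$. Worker $i$ computes a gradient $\nabla f_j(x)$ in at most $\tau_i$ seconds, and a gradient difference $\nabla f_j(x)-\nabla f_j(y)$ in at most $2\tau_i$ seconds. The actual times may depend arbitrarily on the worker and on everything that the server has observed before the computation was requested; the time of a single gradient may also depend on its index $j$, whereas the time of a gradient difference does not depend on the random index being processed. Simultaneous results are received in an arbitrary order that depends only on the observed history and on the finishing times. **Subroutines.** At the start of each call all workers are free (unfinished work of earlier calls is discarded),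 and each is asked for a computation with an independent, uniformly random index in $[m]$. * $\mathrm{ComputeGradient}(x)$ sets $g=0$, $M=\emptyset$. While $M\ne[m]$, it waits for the next gradient $\nabla f_j(x)$ from a worker; if $j\notin M$, it adds $\frac1m\nabla f_j(x)$ to $g$ and $j$ to $M$; then, if $M\neq[m]$, it asks this worker for the gradient with a new index, uniform in $[m]\setminus M$. It returns $g$ (so $g=\nabla f(x)$). * $\mathrm{ComputeBatchDifference}(S,x,y)$ sets $g=0$. For each of the next $S$ received differences it adds $\frac1S(\nabla f_j(x)-\nabla f_j(y))$ to $g$ and asks the worker for the difference with a new index, uniform in $[m]$. It returns $g$. **Freya PAGE.** Given $x^0\in\mathbb R^d$, $S\in\{1,2,\dots\}$, $p\in(0,1]$ and the stepsize $\gamma=\bigl(L_-+L_\pm\sqrt{\tfrac{1-p}{pS}}\bigr)^{-1}$, start at time $0$ with $g^0=\mathrm{ComputeGradient}(x^0)$. In iteration $k=0,1,\dots$ put $x^{k+1}=x^k-\gamma g^k$; with probability $p$ let $g^{k+1}=\mathrm{ComputeGradient}(x^{k+1})$, and otherwise $g^{k+1}=g^k+\mathrm{ComputeBatchDifference}(S,x^{k+1},x^k)$.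 Only the two subroutines take time. (If $L_-+L_\pm\sqrt{(1-p)/(pS)}=0$, then $f$ is constant and we read $\gamma=0$.) **Notation.** Let $\delta^0=f(x^0)-f^*$, $$t^*(s)=\min_{j\in[n]}\Bigl(\sum_{i=1}^j\tfrac1{\tau_i}\Bigr)^{-1}(s+j)\in[0,\infty],\qquad K_{\mathrm{PAGE}}=\frac{2\delta^0}{\varepsilon}\Bigl(L_-+L_\pm\sqrt{\tfrac{1-p}{pS}}\Bigr),$$ with $1/0=\infty$, $1/\infty=0$ and $0\cdot\infty=0$, $$T=12\,t^*(m)+\frac{48\delta^0}{\varepsilon}\Bigl(L_-+L_\pm\sqrt{\tfrac{1-p}{pS}}\Bigr)\bigl[p\,t^*(m)+(1-p)\,t^*(S)\bigr],$$ and $K=\max\{1,\lceil K_{\mathrm{PAGE}}\rceil\}$. **Theorem (time complexity with free parameters $p$ and $S$).** The expected time in which Freya PAGE finds an $\varepsilon$-stationary point is at most $T$. Precisely: let $\hat x^K$ be uniformly random among $x^0,\dots,x^{K-1}$. Then $\mathbb E\|\nabla f(\hat x^K)\|^2\le\varepsilon$. The expected time needed for the computation of $g^0$ and the first $K-1$ iterations,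 after which $x^0,\dots,x^{K-1}$ are all known, is at most $T$. If $K_{\mathrm{PAGE}}\ge\frac12$, then the expected time needed for the computation of $g^0$ and all $K$ iterations is at most $T$ as well. -/

import Mathlib

open scoped ENNReal NNReal

noncomputable section

namespace FreyaPage

/-! ### The finite-sum problem -/

/-- The objective `f = (1/m) ∑ fᵢ` on `ℝᵈ`. -/
def average {m d : ℕ} (F : Fin m → EuclideanSpace ℝ (Fin d) → ℝ) :
    EuclideanSpace ℝ (Fin d) → ℝ :=
  fun x => (1 / (m : ℝ)) * ∑ i, F i x

/-- `f` is `L`-smooth: differentiable with an `L`-Lipschitz gradient. -/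
def IsSmoothWith {d : ℕ} (L : ℝ) (f : EuclideanSpace ℝ (Fin d) → ℝ) : Prop :=
  Differentiable ℝ f ∧ ∀ x y, ‖gradient f x - gradient f y‖ ≤ L * ‖x - y‖

/-- `(1/m) ∑ ‖∇fᵢ(x) - ∇fᵢ(y)‖² ≤ L² ‖x - y‖²`. -/
def MeanSquaredSmooth {m d : ℕ} (L : ℝ) (F : Fin m → EuclideanSpace ℝ (Fin d) → ℝ) : Prop :=
  ∀ x y, (1 / (m : ℝ)) * ∑ i, ‖gradient (F i) x - gradient (F i) y‖ ^ 2 ≤ L ^ 2 * ‖x - y‖ ^ 2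

/-- The Hessian variance condition. -/
def HessianVariance {m d : ℕ} (L : ℝ) (F : Fin m → EuclideanSpace ℝ (Fin d) → ℝ) : Prop :=
  ∀ x y, (1 / (m : ℝ)) * ∑ i, ‖gradient (F i) x - gradient (F i) y -
      (gradient (average F) x - gradient (average F) y)‖ ^ 2 ≤ L ^ 2 * ‖x - y‖ ^ 2

/-- The equilibrium time `t*(S, τ) = min_j (∑_{i ≤ j} 1/τᵢ)⁻¹ (S + j)` in `[0, ∞]`
(`1/0 = ∞` and `1/∞ = 0`). Workers are numbered from `0`, so the `j` of the formula is `j + 1`. -/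
def equilibriumTime {n : ℕ} (S : ℝ≥0) (τ : Fin n → ℝ≥0∞) : ℝ≥0∞ :=
  ⨅ j : Fin n, (∑ i ∈ Finset.Iic j, (τ i)⁻¹)⁻¹ * ((S : ℝ≥0∞) + ((j : ℕ) + 1))

/-- The expectation of a `[0, ∞]`-valued quantity. -/
def expect {α : Type*} (μ : PMF α) (φ : α → ℝ≥0∞) : ℝ≥0∞ := ∑' a, μ a * φ a

/-! ### Workers -/

/-- What the server observes: the outcome of a coin toss, or the arrival of a computation with
index `j` from worker `i`. -/
inductive Event (n m : ℕ) where
  | coin (c : Bool)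
  | arrival (i : Fin n) (j : Fin m)

/-- The computing environment. Histories list the observed events, latest first.

* `gradTime h i j`: the time that worker `i`, asked after the history `h`, takes for the
  gradient of `fⱼ` at one point; at most `τ i`.
* `diffTime h i`: the time that worker `i`, asked after the history `h`, takes for a gradient
  difference `∇fⱼ(x) - ∇fⱼ(y)`, that is for two gradients; at most `2 τ i`. It does not depend on
  the index `j` being processed, so that the first `S` received indices are i.i.d. uniform.
* `next h T`: if worker `i` finishes at time `T i`, the worker whose result is received next: one
  with the least finishing time (ties are broken arbitrarily). -/
structure Environment (n m : ℕ) (τ : Fin n → ℝ≥0∞) where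
  gradTime : List (Event n m) → Fin n → Fin m → ℝ≥0∞
  gradTime_le : ∀ h i j, gradTime h i j ≤ τ i
  diffTime : List (Event n m) → Fin n → ℝ≥0∞
  diffTime_le : ∀ h i, diffTime h i ≤ 2 * τ i
  next : List (Event n m) → (Fin n → ℝ≥0∞) → Fin n
  next_le : ∀ (h : List (Event n m)) (T : Fin n → ℝ≥0∞) (i : Fin n), T (next h T) ≤ T i

/-- The state inside one call of a subroutine: history, clock, the index that each worker
processes, the time at which each worker will finish, and the accumulator `g`. -/
structure Call (n m d : ℕ) where
  hist : List (Event n m)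
  time : ℝ≥0∞
  job : Fin n → Fin m
  finish : Fin n → ℝ≥0∞
  g : EuclideanSpace ℝ (Fin d)

/-- The state inside `ComputeGradient`, with the set `M` of received indices. -/
structure GradCall (n m d : ℕ) extends Call n m d where
  M : Finset (Fin m)

variable {n m d : ℕ} [NeZero m] {τ : Fin n → ℝ≥0∞}

/-! ### `ComputeGradient` -/

/-- Every worker is asked for `∇fⱼ(x)`, with independent uniform `j ∈ [m]`. -/
def gradStart (env : Environment n m τ) (h : List (Event n m)) (t : ℝ≥0∞) :
    PMF (GradCall n m d) :=
  (PMF.uniformOfFintype (Fin n → Fin m)).map fun job =>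
    { hist := h, time := t, job := job, finish := fun i => t + env.gradTime h i (job i),
      g := 0, M := ∅ }

/-- The state after receiving the next gradient in `ComputeGradient`, before reassigning. -/
def gradReceive (env : Environment n m τ) (F : Fin m → EuclideanSpace ℝ (Fin d) → ℝ)
    (x : EuclideanSpace ℝ (Fin d)) (s : GradCall n m d) : GradCall n m d :=
  let w := env.next s.hist s.finish
  let j := s.job w
  { s with
    hist := Event.arrival w j :: s.hist
    time := s.finish w
    g := if j ∈ s.M then s.g else s.g + (1 / (m : ℝ)) • gradient (F j) x
    M := insert j s.M }

/-- The worker `w` is asked for the gradient with index `j`. -/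
def gradAssign (env : Environment n m τ) (w : Fin n) (s : GradCall n m d) (j : Fin m) :
    GradCall n m d :=
  { s with
    job := Function.update s.job w j
    finish := Function.update s.finish w (s.time + env.gradTime s.hist w j) }

/-- One pass of the loop `while M ≠ [m]`: receive the next gradient, and ask the worker that sent it
for a new one, with index uniform in `[m] \ M` (if all the gradients are there, none is asked). -/
def gradStep (env : Environment n m τ) (F : Fin m → EuclideanSpace ℝ (Fin d) → ℝ)
    (x : EuclideanSpace ℝ (Fin d)) (s : GradCall n m d) : PMF (GradCall n m d) :=
  if s.M = Finset.univ then PMF.pure s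
  else
    let s' := gradReceive env F x s
    if hne : (s'.Mᶜ).Nonempty then
      (PMF.uniformOfFinset s'.Mᶜ hne).map (gradAssign env (env.next s.hist s.finish) s')
    else PMF.pure s'

/-- `N` passes of the loop (a pass does nothing once `M = [m]`). -/
def gradLoop (env : Environment n m τ) (F : Fin m → EuclideanSpace ℝ (Fin d) → ℝ)
    (x : EuclideanSpace ℝ (Fin d)) : ℕ → GradCall n m d → PMF (GradCall n m d)
  | 0, s => PMF.pure s
  | N + 1, s => (gradStep env F x s).bind (gradLoop env F x N)

/-- `ComputeGradient(x)`, called at time `t` after history `h`. The loop always ends within `n m`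
passes, see `computeGradient_complete`. -/
def computeGradient (env : Environment n m τ) (F : Fin m → EuclideanSpace ℝ (Fin d) → ℝ)
    (x : EuclideanSpace ℝ (Fin d)) (h : List (Event n m)) (t : ℝ≥0∞) :
    PMF (GradCall n m d) :=
  (gradStart env h t).bind (gradLoop env F x (n * m))

/-! ### `ComputeBatchDifference` -/

/-- Every worker is asked for `∇fⱼ(x) - ∇fⱼ(y)`, with independent uniform `j ∈ [m]`. -/
def diffStart (env : Environment n m τ) (h : List (Event n m)) (t : ℝ≥0∞) :
    PMF (Call n m d) :=
  (PMF.uniformOfFintype (Fin n → Fin m)).map fun job =>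
    { hist := h, time := t, job := job, finish := fun i => t + env.diffTime h i, g := 0 }

/-- One pass of the loop: receive the next difference, add it with weight `1/S`, and ask the
worker that sent it for a new one, with uniform index. -/
def diffStep (env : Environment n m τ) (F : Fin m → EuclideanSpace ℝ (Fin d) → ℝ) (S : ℕ)
    (x y : EuclideanSpace ℝ (Fin d)) (s : Call n m d) : PMF (Call n m d) :=
  let w := env.next s.hist s.finish
  let j := s.job w
  let h := Event.arrival w j :: s.hist
  let t := s.finish w
  (PMF.uniformOfFintype (Fin m)).map fun j' =>
    { hist := h
      time := t
      job := Function.update s.job w j'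
      finish := Function.update s.finish w (t + env.diffTime h w)
      g := s.g + (1 / (S : ℝ)) • (gradient (F j) x - gradient (F j) y) }

/-- `N` passes of the loop. -/
def diffLoop (env : Environment n m τ) (F : Fin m → EuclideanSpace ℝ (Fin d) → ℝ) (S : ℕ)
    (x y : EuclideanSpace ℝ (Fin d)) : ℕ → Call n m d → PMF (Call n m d)
  | 0, s => PMF.pure s
  | N + 1, s => (diffStep env F S x y s).bind (diffLoop env F S x y N)

/-- `ComputeBatchDifference(S, x, y)`, called at time `t` after history `h`. -/
def computeBatchDifference (env : Environment n m τ)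
    (F : Fin m → EuclideanSpace ℝ (Fin d) → ℝ) (S : ℕ) (x y : EuclideanSpace ℝ (Fin d))
    (h : List (Event n m)) (t : ℝ≥0∞) : PMF (Call n m d) :=
  (diffStart env h t).bind (diffLoop env F S x y S)

/-! ### Freya PAGE -/

/-- The state after `k` iterations: history, clock, the iterates `x 0, …, x k` (the values `x i`
with `i > k` have no meaning yet) and the estimator `g = gᵏ`. -/
structure State (n m d : ℕ) where
  hist : List (Event n m)
  time : ℝ≥0∞
  x : ℕ → EuclideanSpace ℝ (Fin d)
  g : EuclideanSpace ℝ (Fin d)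

/-- The preprocessing: `g⁰ = ∇f(x⁰)` by `ComputeGradient`, starting at time `0`. -/
def init (env : Environment n m τ) (F : Fin m → EuclideanSpace ℝ (Fin d) → ℝ)
    (x₀ : EuclideanSpace ℝ (Fin d)) : PMF (State n m d) :=
  (computeGradient env F x₀ [] 0).map fun r =>
    { hist := r.hist, time := r.time, x := fun _ => x₀, g := r.g }

/-- Iteration `k`, after the coin has shown `c`. -/
def stepWithCoin (env : Environment n m τ) (F : Fin m → EuclideanSpace ℝ (Fin d) → ℝ)
    (γ : ℝ) (S k : ℕ) (s : State n m d) (c : Bool) : PMF (State n m d) :=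
  let x' := s.x k - γ • s.g
  let h := Event.coin c :: s.hist
  if c then
    (computeGradient env F x' h s.time).map fun r =>
      { hist := r.hist, time := r.time, x := Function.update s.x (k + 1) x', g := r.g }
  else
    (computeBatchDifference env F S x' (s.x k) h s.time).map fun r =>
      { hist := r.hist, time := r.time, x := Function.update s.x (k + 1) x', g := s.g + r.g }

/-- A coin that shows `true` with probability `p`. -/
def coin (p : ℝ≥0) (hp : p ≤ 1) : PMF Bool :=
  PMF.ofFintype (fun c => ((if c then p else 1 - p : ℝ≥0) : ℝ≥0∞)) (by
    rw [Fintype.sum_bool]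
    norm_cast
    simp [hp])

/-- Iteration `k`, with a coin that shows `true` with probability `p`. -/
def step (env : Environment n m τ) (F : Fin m → EuclideanSpace ℝ (Fin d) → ℝ)
    (γ : ℝ) (S : ℕ) (p : ℝ≥0) (hp : p ≤ 1) (k : ℕ) (s : State n m d) : PMF (State n m d) :=
  (coin p hp).bind (stepWithCoin env F γ S k s)

/-- The law of the state after the preprocessing and `K` iterations. -/
def run (env : Environment n m τ) (F : Fin m → EuclideanSpace ℝ (Fin d) → ℝ)
    (x₀ : EuclideanSpace ℝ (Fin d)) (γ : ℝ) (S : ℕ) (p : ℝ≥0) (hp : p ≤ 1) :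
    ℕ → PMF (State n m d)
  | 0 => init env F x₀
  | K + 1 => (run env F x₀ γ S p hp K).bind (step env F γ S p hp K)

/-- The law of `x̂ᴷ`, uniformly random among `x⁰, …, xᴷ⁻¹`. The last of these points is known
after `K - 1` iterations. -/
def output (env : Environment n m τ) (F : Fin m → EuclideanSpace ℝ (Fin d) → ℝ)
    (x₀ : EuclideanSpace ℝ (Fin d)) (γ : ℝ) (S : ℕ) (p : ℝ≥0) (hp : p ≤ 1)
    (K : ℕ) (hK : 0 < K) : PMF (EuclideanSpace ℝ (Fin d)) :=
  (run env F x₀ γ S p hp (K - 1)).bind fun s =>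
    (PMF.uniformOfFinset (Finset.range K) (Finset.nonempty_range_iff.mpr hK.ne')).map s.x

/-! ### Parameters and bounds -/

/-- `L₋ + L± √((1 - p) / (p S))`. -/
def rate (Lm Lpm : ℝ) (p : ℝ≥0) (S : ℕ) : ℝ :=
  Lm + Lpm * √((1 - (p : ℝ)) / ((p : ℝ) * (S : ℝ)))

/-- `K_PAGE = (2 δ⁰ / ε) (L₋ + L± √((1 - p) / (p S)))`. -/
def pageIterations (Lm Lpm δ₀ ε : ℝ) (p : ℝ≥0) (S : ℕ) : ℝ :=
  2 * δ₀ / ε * rate Lm Lpm p S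

/-- `12 t*(m) + (48 δ⁰ / ε) (L₋ + L± √((1 - p) / (p S))) (p t*(m) + (1 - p) t*(S))`. -/
def timeBound (m : ℕ) (τ : Fin n → ℝ≥0∞) (Lm Lpm δ₀ ε : ℝ) (p : ℝ≥0) (S : ℕ) : ℝ≥0∞ :=
  12 * equilibriumTime (m : ℝ≥0) τ +
    ENNReal.ofReal (48 * δ₀ / ε * rate Lm Lpm p S) *
      ((p : ℝ≥0∞) * equilibriumTime (m : ℝ≥0) τ +
        ((1 - p : ℝ≥0) : ℝ≥0∞) * equilibriumTime (S : ℝ≥0) τ)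

/-! ### The loop of `ComputeGradient` ends -/

/-- The number of workers whose pending index has been received already. -/
def staleCount (s : GradCall n m d) : ℕ := (Finset.univ.filter fun i => s.job i ∈ s.M).card

theorem gradStep_measure (env : Environment n m τ) (F : Fin m → EuclideanSpace ℝ (Fin d) → ℝ)
    (x : EuclideanSpace ℝ (Fin d)) (s s' : GradCall n m d) (N : ℕ)
    (hN : s.M = Finset.univ ∨ n * s.Mᶜ.card + staleCount s ≤ N + 1)
    (hs' : s' ∈ (gradStep env F x s).support) :
    s'.M = Finset.univ ∨ n * s'.Mᶜ.card + staleCount s' ≤ N := by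
  classical
  by_cases hM : s.M = Finset.univ
  · simp [gradStep, hM] at hs'
    exact Or.inl (hs' ▸ hM)
  have hN : n * s.Mᶜ.card + staleCount s ≤ N + 1 := hN.resolve_left hM
  rw [gradStep, if_neg hM] at hs'
  dsimp only at hs'
  set w := env.next s.hist s.finish with hw
  by_cases hne : ((gradReceive env F x s).Mᶜ).Nonempty
  swap
  · rw [dif_neg hne] at hs'
    simp only [PMF.support_pure, Set.mem_singleton_iff] at hs'
    left
    rw [hs']
    simpa [Finset.not_nonempty_iff_eq_empty, Finset.compl_eq_empty_iff] using hne
  right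
  rw [dif_pos hne, PMF.mem_support_map_iff] at hs'
  obtain ⟨j', hj', rfl⟩ := hs'
  rw [PMF.mem_support_uniformOfFinset_iff, Finset.mem_compl] at hj'
  have hMr : (gradReceive env F x s).M = insert (s.job w) s.M := rfl
  have hJr : (gradReceive env F x s).job = s.job := rfl
  rw [hMr] at hj'
  simp only [staleCount, gradAssign, hMr, hJr]
  have hwn : w ∉ (Finset.univ : Finset (Fin n)).filter
      (fun i => Function.update s.job w j' i ∈ insert (s.job w) s.M) := by
    simpa using hj'
  by_cases hj : s.job w ∈ s.M
  · rw [Finset.insert_eq_of_mem hj] at hwn ⊢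
    have : (Finset.univ.filter fun i => Function.update s.job w j' i ∈ s.M).card
        < (Finset.univ.filter fun i => s.job i ∈ s.M).card := by
      apply Finset.card_lt_card
      refine Finset.ssubset_iff.mpr ⟨w, hwn, ?_⟩
      intro i hi
      rcases Finset.mem_insert.mp hi with rfl | hi
      · simpa using hj
      · have hiw : i ≠ w := fun h => hwn (h ▸ hi)
        simpa [Function.update_of_ne hiw] using hi
    unfold staleCount at hN
    omega
  · have h1 : (insert (s.job w) s.M)ᶜ.card + 1 = s.Mᶜ.card := by
      have h2 : s.job w ∈ s.Mᶜ := by simpa using hj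
      rw [Finset.compl_insert, Finset.card_erase_add_one h2]
    have h3 : (Finset.univ.filter fun i =>
        Function.update s.job w j' i ∈ insert (s.job w) s.M).card < n := by
      have := Finset.card_lt_univ_of_notMem hwn
      simpa using this
    rw [← h1] at hN
    rw [Nat.mul_add] at hN
    omega

theorem gradLoop_complete (env : Environment n m τ)
    (F : Fin m → EuclideanSpace ℝ (Fin d) → ℝ) (x : EuclideanSpace ℝ (Fin d)) (N : ℕ)
    (s s' : GradCall n m d) (hN : s.M = Finset.univ ∨ n * s.Mᶜ.card + staleCount s ≤ N)
    (hn : 0 < n) (hs' : s' ∈ (gradLoop env F x N s).support) : s'.M = Finset.univ := by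
  induction N generalizing s with
  | zero =>
    simp only [gradLoop, PMF.support_pure, Set.mem_singleton_iff] at hs'
    subst hs'
    rcases hN with h | h
    · exact h
    · have h4 : n * s'.Mᶜ.card = 0 := by omega
      have h5 : s'.Mᶜ.card = 0 := (Nat.mul_eq_zero.mp h4).resolve_left hn.ne'
      simpa using h5
  | succ N ih =>
    rw [gradLoop, PMF.mem_support_bind_iff] at hs'
    obtain ⟨s₁, h₁, h₂⟩ := hs'
    exact ih s₁ (gradStep_measure env F x s s₁ N hN h₁) h₂

/-- `ComputeGradient` returns only once all the gradients have been received. -/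
theorem computeGradient_complete (env : Environment n m τ)
    (F : Fin m → EuclideanSpace ℝ (Fin d) → ℝ) (x : EuclideanSpace ℝ (Fin d))
    (h : List (Event n m)) (t : ℝ≥0∞) (s : GradCall n m d)
    (hs : s ∈ (computeGradient env F x h t).support) : s.M = Finset.univ := by
  rw [computeGradient, PMF.mem_support_bind_iff] at hs
  obtain ⟨s₀, h₀, h₁⟩ := hs
  rw [gradStart, PMF.mem_support_map_iff] at h₀
  obtain ⟨job, -, rfl⟩ := h₀
  refine gradLoop_complete env F x (n * m) _ s (Or.inr ?_) ?_ h₁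
  · simp [staleCount]
  · exact Fin.pos (env.next [] fun _ => 0)

end FreyaPage

end

noncomputable section

namespace FreyaPage

/-! ### Expectations -/

section Expect

variable {α β : Type*}

/-! Convergence and running time are separate supermartingale arguments.

Convergence: by the descent lemma one step costs the estimator error `γ/2 ‖g - ∇f‖²` and gains `γ/2
‖∇f‖² + γ/2 (1 - γL₋) ‖g‖²`. With probability `p` the error is reset to zero. Otherwise it grows in
mean by at most `L±² γ² ‖g‖² / S`, because the indices received in a batch are independent and
uniform: arrival times do not depend on pending indices, so these stay uniform given the history
(`expect_diffLoop_le`). Weighting the error by `γ/(2p)` balances everything for the given stepsize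
(`expect_step_lyapunov_le`).

Time per result: the potential `∑ (finishᵢ - t₀)/cᵢ` over the first `j` workers starts at most at
`j` and rises by at most one per received result, while the clock is below every finishing time. So
`k` results take at most `(∑ 1/cᵢ)⁻¹ (k + j)` seconds, surely. This settles batches, where `k = S`.

For full gradients `k` is random, and the environment may delay chosen indices, so this is a coupon
collector problem against an adversary. The potential `pending` charges stale workers, squared loads
of missing indices, and a harmonic sum over their number. One pass lowers it by at least one in
mean, whichever worker arrives (`expect_gradStep_le`). Its initial mean is at most `7m` when `n log
n ≤ m` (`average_pending_empty_le`), so a full gradient takes at most `12 t*(m)` in mean. -/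

theorem expect_pure (a : α) (φ : α → ℝ≥0∞) : expect (PMF.pure a) φ = φ a := by
  unfold expect
  rw [tsum_eq_single a]
  · simp
  · intro b hb
    simp [PMF.pure_apply, hb]

theorem expect_bind (μ : PMF α) (κ : α → PMF β) (φ : β → ℝ≥0∞) :
    expect (μ.bind κ) φ = expect μ fun a => expect (κ a) φ := by
  unfold expect
  simp_rw [PMF.bind_apply, ← ENNReal.tsum_mul_right, ← ENNReal.tsum_mul_left, mul_assoc]
  exact ENNReal.tsum_comm

theorem expect_map (μ : PMF α) (f : α → β) (φ : β → ℝ≥0∞) :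
    expect (μ.map f) φ = expect μ fun a => φ (f a) := by
  rw [← PMF.bind_pure_comp, expect_bind]
  simp [expect_pure]

theorem expect_mono_of_support (μ : PMF α) {φ ψ : α → ℝ≥0∞}
    (h : ∀ a ∈ μ.support, φ a ≤ ψ a) : expect μ φ ≤ expect μ ψ := by
  refine ENNReal.tsum_le_tsum fun a => ?_
  by_cases ha : a ∈ μ.support
  · gcongr
    exact h a ha
  · rw [PMF.mem_support_iff, not_not] at ha
    simp [ha]

theorem expect_mono (μ : PMF α) {φ ψ : α → ℝ≥0∞} (h : ∀ a, φ a ≤ ψ a) :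
    expect μ φ ≤ expect μ ψ :=
  expect_mono_of_support μ fun a _ => h a

theorem expect_add (μ : PMF α) (φ ψ : α → ℝ≥0∞) :
    expect μ (fun a => φ a + ψ a) = expect μ φ + expect μ ψ := by
  simp only [expect, mul_add, ENNReal.tsum_add]

theorem expect_const (μ : PMF α) (c : ℝ≥0∞) : expect μ (fun _ => c) = c := by
  simp [expect, ENNReal.tsum_mul_right, μ.tsum_coe]

theorem expect_const_mul (μ : PMF α) (c : ℝ≥0∞) (φ : α → ℝ≥0∞) :
    expect μ (fun a => c * φ a) = c * expect μ φ := by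
  simp only [expect, ← ENNReal.tsum_mul_left]
  congr 1
  ext a
  ring

theorem expect_uniformOfFinset (A : Finset α) (hA : A.Nonempty) (φ : α → ℝ) (hφ : ∀ a, 0 ≤ φ a) :
    expect (PMF.uniformOfFinset A hA) (fun a => ENNReal.ofReal (φ a)) =
      ENNReal.ofReal ((∑ a ∈ A, φ a) / A.card) := by
  classical
  have hc : (0 : ℝ) < A.card := by exact_mod_cast hA.card_pos
  unfold expect
  rw [tsum_eq_sum (s := A)]
  · rw [div_eq_inv_mul, ENNReal.ofReal_mul (by positivity), ENNReal.ofReal_sum_of_nonneg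
      (fun a _ => hφ a), Finset.mul_sum]
    refine Finset.sum_congr rfl fun a ha => ?_
    rw [PMF.uniformOfFinset_apply_of_mem _ ha, ENNReal.ofReal_inv_of_pos hc, ENNReal.ofReal_natCast]
  · intro a ha
    rw [PMF.uniformOfFinset_apply_of_notMem _ ha, zero_mul]

theorem expect_uniformOfFintype [Fintype α] [Nonempty α] (φ : α → ℝ) (hφ : ∀ a, 0 ≤ φ a) :
    expect (PMF.uniformOfFintype α) (fun a => ENNReal.ofReal (φ a)) =
      ENNReal.ofReal ((∑ a, φ a) / Fintype.card α) := by
  have h := expect_uniformOfFinset (Finset.univ : Finset α) Finset.univ_nonempty φ hφ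
  simpa [PMF.uniformOfFintype] using h

theorem expect_coin (p : ℝ≥0) (hp : p ≤ 1) (φ : Bool → ℝ≥0∞) :
    expect (coin p hp) φ = (p : ℝ≥0∞) * φ true + ((1 - p : ℝ≥0) : ℝ≥0∞) * φ false := by
  simp [expect, coin]

theorem coe_add_coe_one_sub (p : ℝ≥0) (hp : p ≤ 1) :
    (p : ℝ≥0∞) + ((1 - p : ℝ≥0) : ℝ≥0∞) = 1 := by
  rw [← ENNReal.coe_add, add_tsub_cancel_of_le hp, ENNReal.coe_one]

/-- Resampling one coordinate of a uniform vector leaves it uniform, and independent of the old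
value of the coordinate. -/
theorem expect_uniform_resample {ι κ : Type*} [Fintype ι] [Fintype κ] [DecidableEq ι] [Nonempty κ]
    (w : ι) (φ : κ → (ι → κ) → ℝ≥0∞) :
    (expect (PMF.uniformOfFintype (ι → κ)) fun job =>
        expect (PMF.uniformOfFintype κ) fun j' => φ (job w) (Function.update job w j')) =
      expect (PMF.uniformOfFintype κ) fun j =>
        expect (PMF.uniformOfFintype (ι → κ)) fun job => φ j job := by
  simp only [expect, PMF.uniformOfFintype_apply, tsum_fintype, ← Finset.mul_sum]
  rw [mul_left_comm]
  congr 2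
  rw [Finset.sum_comm (s := (Finset.univ : Finset κ)), ← Finset.sum_product',
    ← Finset.sum_product']
  refine Finset.sum_nbij' (fun q => (Function.update q.1 w q.2, q.1 w))
    (fun q => (Function.update q.1 w q.2, q.1 w)) ?_ ?_ ?_ ?_ ?_ <;> simp

end Expect

section

variable {n m d : ℕ} {τ : Fin n → ℝ≥0∞}

/-! ### Time and number of received results -/

/-- A clock that stands at `T`, no later than the finishing time of any worker, satisfies
`T ≤ t₀ + (∑ 1/cᵢ)⁻¹ B` if the weighted finishing times satisfy `∑ (finishᵢ - t₀)/cᵢ ≤ B`. -/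
theorem le_add_of_potential (A : Finset (Fin n)) (c finish : Fin n → ℝ≥0∞) (t₀ T B : ℝ≥0∞)
    (hT : ∀ i, T ≤ finish i) (h : ∑ i ∈ A, (finish i - t₀) * (c i)⁻¹ ≤ B) (hB0 : B ≠ 0)
    (hB : B ≠ ∞) :
    T ≤ t₀ + (∑ i ∈ A, (c i)⁻¹)⁻¹ * B := by
  have h1 : (T - t₀) * ∑ i ∈ A, (c i)⁻¹ ≤ B := by
    rw [Finset.mul_sum]
    refine le_trans (Finset.sum_le_sum fun i _ => ?_) h
    gcongr
    exact hT i
  have h2 : T - t₀ ≤ (∑ i ∈ A, (c i)⁻¹)⁻¹ * B := by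
    rw [mul_comm, ← div_eq_mul_inv]
    -- `B ≠ 0` and `B ≠ ∞` cover the cases in which the total speed is `0` or `∞`.
    rw [ENNReal.le_div_iff_mul_le (Or.inr hB0) (Or.inr hB)]
    exact h1
  exact le_add_tsub.trans (by gcongr)

/-- Each worker contributes at most `cᵢ · cᵢ⁻¹ ≤ 1`, which also holds for `cᵢ` equal to `0` or `∞`.
-/
theorem potential_start (A : Finset (Fin n)) (c δ : Fin n → ℝ≥0∞) (t₀ : ℝ≥0∞)
    (hδ : ∀ i, δ i ≤ c i) :
    ∑ i ∈ A, (t₀ + δ i - t₀) * (c i)⁻¹ ≤ A.card := by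
  rw [← nsmul_one, ← Finset.sum_const]
  refine Finset.sum_le_sum fun i _ => ?_
  refine le_trans ?_ (ENNReal.mul_inv_le_one (c i))
  gcongr
  rw [tsub_le_iff_left]
  gcongr
  exact hδ i

/-- Only the term of `w` changes, and it grows by at most `c w · (c w)⁻¹ ≤ 1`. -/
theorem potential_update (A : Finset (Fin n)) (c finish : Fin n → ℝ≥0∞) (t₀ δ B : ℝ≥0∞)
    (w : Fin n) (hδ : δ ≤ c w) (h : ∑ i ∈ A, (finish i - t₀) * (c i)⁻¹ ≤ B) :
    ∑ i ∈ A, (Function.update finish w (finish w + δ) i - t₀) * (c i)⁻¹ ≤ B + 1 := by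
  have key : ∀ i, (Function.update finish w (finish w + δ) i - t₀) * (c i)⁻¹ ≤
      (finish i - t₀) * (c i)⁻¹ + if i = w then 1 else 0 := by
    intro i
    by_cases hi : i = w
    · subst hi
      simp only [Function.update_self, if_true]
      calc (finish i + δ - t₀) * (c i)⁻¹ ≤ ((finish i - t₀) + c i) * (c i)⁻¹ := by
            gcongr
            rw [tsub_le_iff_left, ← add_assoc]
            gcongr
            exact le_add_tsub
        _ ≤ _ := by
            rw [add_mul]
            gcongr
            exact ENNReal.mul_inv_le_one _
    · simp [hi]
  refine (Finset.sum_le_sum fun i _ => key i).trans ?_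
  rw [Finset.sum_add_distrib]
  gcongr
  rw [Finset.sum_ite_eq']
  split_ifs <;> simp

theorem card_Iic_fin (j : Fin n) : ((Finset.Iic j).card : ℝ≥0∞) = (j : ℕ) + 1 := by
  simp

/-! ### `ComputeBatchDifference`: time -/

/-- The budget `B` bounds the potential and grows by one with each reassignment; the clock after a
reception is bounded by the budget held before it. -/
theorem diffLoop_time_le [NeZero m] (env : Environment n m τ) (F : Fin m → EuclideanSpace ℝ (Fin d) → ℝ)
    (S : ℕ) (x y : EuclideanSpace ℝ (Fin d)) (A : Finset (Fin n)) (t₀ : ℝ≥0∞)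
    (N : ℕ) (B : ℝ≥0∞) (hB0 : B ≠ 0) (hB : B ≠ ∞) (s s' : Call n m d)
    (hs : ∑ i ∈ A, (s.finish i - t₀) * (2 * τ i)⁻¹ ≤ B)
    (htime : s.time ≤ t₀ + (∑ i ∈ A, (2 * τ i)⁻¹)⁻¹ * B)
    (hs' : s' ∈ (diffLoop env F S x y N s).support) :
    s'.time ≤ t₀ + (∑ i ∈ A, (2 * τ i)⁻¹)⁻¹ * (B + N) := by
  induction N generalizing s B with
  | zero =>
    simp only [diffLoop, PMF.support_pure, Set.mem_singleton_iff] at hs'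
    subst hs'
    simpa using htime
  | succ N ih =>
    rw [diffLoop, PMF.mem_support_bind_iff] at hs'
    obtain ⟨s₁, h₁, h₂⟩ := hs'
    rw [diffStep, PMF.mem_support_map_iff] at h₁
    obtain ⟨j', -, rfl⟩ := h₁
    have h := ih (B + 1) (by simp) (by simp [hB]) _ ?_ ?_ h₂
    · refine h.trans_eq ?_
      push_cast
      ring
    · exact potential_update A (fun i => 2 * τ i) s.finish t₀ _ B _ (env.diffTime_le _ _) hs
    · dsimp only
      refine (le_add_of_potential A (fun i => 2 * τ i) s.finish t₀ _ B
        (env.next_le s.hist s.finish) hs hB0 hB).trans ?_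
      gcongr
      simp

theorem computeBatchDifference_time_le [NeZero m] (env : Environment n m τ)
    (F : Fin m → EuclideanSpace ℝ (Fin d) → ℝ)
    (S : ℕ) (x y : EuclideanSpace ℝ (Fin d)) (h : List (Event n m)) (t : ℝ≥0∞) (s : Call n m d)
    (hs : s ∈ (computeBatchDifference env F S x y h t).support) :
    s.time ≤ t + 2 * equilibriumTime (S : ℝ≥0) τ := by
  have key : ∀ j : Fin n, s.time ≤ t + 2 * ((∑ i ∈ Finset.Iic j, (τ i)⁻¹)⁻¹ *
      (((S : ℝ≥0) : ℝ≥0∞) + ((j : ℕ) + 1))) := by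
    intro j
    rw [computeBatchDifference, PMF.mem_support_bind_iff] at hs
    obtain ⟨s₀, h₀, h₁⟩ := hs
    rw [diffStart, PMF.mem_support_map_iff] at h₀
    obtain ⟨job, -, rfl⟩ := h₀
    have := diffLoop_time_le env F S x y (Finset.Iic j) t S ((j : ℕ) + 1) (by simp) (by finiteness)
      _ s (by
        rw [← card_Iic_fin]
        exact potential_start _ (fun i => 2 * τ i) _ t (env.diffTime_le h)) (by simp) h₁
    refine this.trans_eq ?_
    have h2 : ∀ i, (2 * τ i)⁻¹ = 2⁻¹ * (τ i)⁻¹ := fun i =>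
      ENNReal.mul_inv (Or.inl (by simp)) (Or.inl (by simp))
    simp_rw [h2, ← Finset.mul_sum]
    rw [ENNReal.mul_inv (Or.inl (by simp)) (Or.inl (by simp)), inv_inv]
    push_cast
    ring
  rw [equilibriumTime, ENNReal.mul_iInf_of_ne (by simp) (by simp), ENNReal.add_iInf]
  exact le_iInf key

/-! ### `ComputeGradient`: time in terms of the number of results -/

/-- The history grows by one per reception, so its length minus the initial length `L₀` counts the
received gradients. Terms in `L₀` are added on the other side to avoid truncated subtraction. Once
`M = [m]` the loop is idle and the potential is no longer needed. -/
theorem gradLoop_time_le (env : Environment n m τ) (F : Fin m → EuclideanSpace ℝ (Fin d) → ℝ)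
    (x : EuclideanSpace ℝ (Fin d)) (A : Finset (Fin n)) (t₀ : ℝ≥0∞) (L₀ : ℕ)
    (C : ℝ≥0∞) (hC0 : C ≠ 0) (hC : C ≠ ∞) (N : ℕ) (s s' : GradCall n m d)
    (hs : s.M = Finset.univ ∨ ∑ i ∈ A, (s.finish i - t₀) * (τ i)⁻¹ + L₀ ≤ C + s.hist.length)
    (hL : L₀ ≤ s.hist.length)
    (htime : s.time + (∑ i ∈ A, (τ i)⁻¹)⁻¹ * L₀ ≤
      t₀ + (∑ i ∈ A, (τ i)⁻¹)⁻¹ * (C + s.hist.length))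
    (hs' : s' ∈ (gradLoop env F x N s).support) :
    s'.time + (∑ i ∈ A, (τ i)⁻¹)⁻¹ * L₀ ≤
      t₀ + (∑ i ∈ A, (τ i)⁻¹)⁻¹ * (C + s'.hist.length) := by
  induction N generalizing s with
  | zero =>
    simp only [gradLoop, PMF.support_pure, Set.mem_singleton_iff] at hs'
    subst hs'
    exact htime
  | succ N ih =>
    rw [gradLoop, PMF.mem_support_bind_iff] at hs'
    obtain ⟨s₁, h₁, h₂⟩ := hs'
    by_cases hM : s.M = Finset.univ
    · simp only [gradStep, if_pos hM, PMF.support_pure, Set.mem_singleton_iff] at h₁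
      subst h₁
      exact ih _ hs hL htime h₂
    replace hs := hs.resolve_left hM
    obtain ⟨k, hk⟩ := Nat.exists_eq_add_of_le hL
    have hs2 : ∑ i ∈ A, (s.finish i - t₀) * (τ i)⁻¹ ≤ C + k := by
      rw [hk] at hs
      push_cast at hs
      rw [← add_assoc, add_right_comm C] at hs
      exact (ENNReal.add_le_add_iff_right (by simp)).mp hs
    have ht2 : s.finish (env.next s.hist s.finish) ≤ t₀ + (∑ i ∈ A, (τ i)⁻¹)⁻¹ * (C + k) :=
      le_add_of_potential A τ s.finish t₀ _ _ (env.next_le s.hist s.finish) hs2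
        (by simp [hC0]) (by simp [hC])
    have ht3 : s.finish (env.next s.hist s.finish) + (∑ i ∈ A, (τ i)⁻¹)⁻¹ * L₀ ≤
        t₀ + (∑ i ∈ A, (τ i)⁻¹)⁻¹ * (C + (s.hist.length + 1 : ℕ)) := by
      calc _ ≤ t₀ + (∑ i ∈ A, (τ i)⁻¹)⁻¹ * (C + k) + (∑ i ∈ A, (τ i)⁻¹)⁻¹ * L₀ := by gcongr
        _ = t₀ + (∑ i ∈ A, (τ i)⁻¹)⁻¹ * (C + s.hist.length) := by
          rw [hk]
          push_cast
          ring
        _ ≤ _ := by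
          gcongr
          simp
    rw [gradStep, if_neg hM] at h₁
    dsimp only at h₁
    by_cases hne : ((gradReceive env F x s).Mᶜ).Nonempty
    · rw [dif_pos hne, PMF.mem_support_map_iff] at h₁
      obtain ⟨j', -, rfl⟩ := h₁
      refine ih _ (Or.inr ?_) ?_ ?_ h₂
      · have h := potential_update A τ s.finish t₀ _ _ (env.next s.hist s.finish)
          (env.gradTime_le (gradReceive env F x s).hist (env.next s.hist s.finish) j') hs2
        have h' : (C + k + 1 : ℝ≥0∞) + L₀ = C + ((s.hist.length + 1 : ℕ) : ℝ≥0∞) := by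
          rw [hk]
          push_cast
          ring
        exact (add_le_add_left h (L₀ : ℝ≥0∞)).trans_eq h'
      · simp only [gradAssign, gradReceive, List.length_cons]
        omega
      · simp only [gradAssign, gradReceive, List.length_cons]
        exact ht3
    · rw [dif_neg hne] at h₁
      simp only [PMF.support_pure, Set.mem_singleton_iff] at h₁
      subst h₁
      refine ih _ (Or.inl ?_) ?_ ?_ h₂
      · simpa [Finset.not_nonempty_iff_eq_empty, Finset.compl_eq_empty_iff] using hne
      · simp only [gradReceive, List.length_cons]
        omega
      · simp only [gradReceive, List.length_cons]
        exact ht3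

/-- Receiving `k` gradients takes at most `(∑_{i ≤ j} 1/τᵢ)⁻¹ (k + j)` seconds. -/
theorem computeGradient_time_le [NeZero m] (env : Environment n m τ)
    (F : Fin m → EuclideanSpace ℝ (Fin d) → ℝ) (x : EuclideanSpace ℝ (Fin d))
    (h : List (Event n m)) (t : ℝ≥0∞) (j : Fin n) (s : GradCall n m d)
    (hs : s ∈ (computeGradient env F x h t).support) :
    s.time + (∑ i ∈ Finset.Iic j, (τ i)⁻¹)⁻¹ * h.length ≤
      t + (∑ i ∈ Finset.Iic j, (τ i)⁻¹)⁻¹ * ((j : ℕ) + 1 + s.hist.length) := by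
  rw [computeGradient, PMF.mem_support_bind_iff] at hs
  obtain ⟨s₀, h₀, h₁⟩ := hs
  rw [gradStart, PMF.mem_support_map_iff] at h₀
  obtain ⟨job, -, rfl⟩ := h₀
  refine gradLoop_time_le env F x (Finset.Iic j) t h.length ((j : ℕ) + 1) (by simp)
    (by finiteness) (n * m) _ s (Or.inr ?_) le_rfl ?_ h₁
  · dsimp only
    gcongr
    rw [← card_Iic_fin]
    exact potential_start _ τ _ t fun i => env.gradTime_le h i (job i)
  · dsimp only
    gcongr
    simp

end

section

variable {n m d : ℕ} {τ : Fin n → ℝ≥0∞}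

/-! ### The number of gradients received by `ComputeGradient` -/

/-- The number of workers that process the index `j`. -/
def load (job : Fin n → Fin m) (j : Fin m) : ℝ :=
  ∑ i, if job i = j then 1 else 0

/-- The number of workers that process an index in `M`. -/
def stale (job : Fin n → Fin m) (M : Finset (Fin m)) : ℝ := ∑ j ∈ M, load job j

/-- The weight of the squared loads in `pending`, when `r` indices are missing. -/
def loadWeight (n r : ℕ) : ℝ := r / (2 * (n + r))

/-- A bound for the expected number of gradients that are still to be received, when the workers
process the indices `job` and those in `M` have been received. -/
def pending (job : Fin n → Fin m) (M : Finset (Fin m)) : ℝ :=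
  (∑ i ∈ Finset.range Mᶜ.card, (2 * n / ((i : ℝ) + 1) + 2)) + 2 * stale job M +
    loadWeight n Mᶜ.card * ∑ j ∈ Mᶜ, load job j ^ 2

theorem load_nonneg (job : Fin n → Fin m) (j : Fin m) : 0 ≤ load job j :=
  Finset.sum_nonneg fun _ _ => by split_ifs <;> simp

theorem sum_load (job : Fin n → Fin m) : ∑ j, load job j = n := by
  simp only [load]
  rw [Finset.sum_comm]
  simp

theorem stale_nonneg (job : Fin n → Fin m) (M : Finset (Fin m)) : 0 ≤ stale job M :=
  Finset.sum_nonneg fun _ _ => load_nonneg _ _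

theorem sum_load_le (job : Fin n → Fin m) (M : Finset (Fin m)) : ∑ j ∈ M, load job j ≤ n := by
  rw [← sum_load job]
  exact Finset.sum_le_sum_of_subset_of_nonneg (Finset.subset_univ _) fun _ _ _ => load_nonneg _ _

theorem loadWeight_nonneg (n r : ℕ) : 0 ≤ loadWeight n r := by
  unfold loadWeight
  positivity

theorem loadWeight_mono (n r : ℕ) : loadWeight n r ≤ loadWeight n (r + 1) := by
  unfold loadWeight
  rcases Nat.eq_zero_or_pos (n + r) with h | h
  · obtain ⟨rfl, rfl⟩ := Nat.add_eq_zero_iff.mp h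
    simp
  · have h' : (0 : ℝ) < n + r := by exact_mod_cast h
    push_cast
    rw [div_le_div_iff₀ (by positivity) (by positivity)]
    nlinarith [(Nat.cast_nonneg n : (0 : ℝ) ≤ n)]

theorem pending_nonneg (job : Fin n → Fin m) (M : Finset (Fin m)) : 0 ≤ pending job M := by
  have h1 := stale_nonneg job M
  have h2 := loadWeight_nonneg n Mᶜ.card
  unfold pending
  positivity

theorem load_update (job : Fin n → Fin m) (w : Fin n) (j' j : Fin m) :
    load (Function.update job w j') j =
      load job j - (if job w = j then 1 else 0) + if j' = j then 1 else 0 := by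
  simp only [load]
  rw [← Finset.add_sum_erase _ _ (Finset.mem_univ w),
    ← Finset.add_sum_erase _ (fun i => if job i = j then (1 : ℝ) else 0) (Finset.mem_univ w)]
  have : ∀ i ∈ Finset.univ.erase w, (if Function.update job w j' i = j then (1 : ℝ) else 0) =
      if job i = j then 1 else 0 := fun i hi => by
    rw [Function.update_of_ne (Finset.ne_of_mem_erase hi)]
  rw [Finset.sum_congr rfl this, Function.update_self]
  ring

theorem stale_update (job : Fin n → Fin m) (M : Finset (Fin m)) (w : Fin n) (j' : Fin m)
    (hw : job w ∈ M) (hj' : j' ∉ M) :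
    stale (Function.update job w j') M = stale job M - 1 := by
  simp [stale, load_update, Finset.sum_add_distrib, Finset.sum_sub_distrib, hw, hj']

theorem sum_sq_load_update (job : Fin n → Fin m) (M : Finset (Fin m)) (w : Fin n) (j' : Fin m)
    (hw : job w ∈ M) (hj' : j' ∉ M) :
    ∑ j ∈ Mᶜ, load (Function.update job w j') j ^ 2 =
      ∑ j ∈ Mᶜ, load job j ^ 2 + 2 * load job j' + 1 := by
  have h : ∀ j ∈ Mᶜ, load (Function.update job w j') j ^ 2 =
      load job j ^ 2 + (if j' = j then 2 * load job j' + 1 else 0) := by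
    intro j hj
    rw [Finset.mem_compl] at hj
    rw [load_update, if_neg (fun h : job w = j => hj (h ▸ hw))]
    split_ifs with hjj
    · subst hjj
      ring
    · ring
  rw [Finset.sum_congr rfl h, Finset.sum_add_distrib, Finset.sum_ite_eq,
    if_pos (Finset.mem_compl.mpr hj')]
  ring

/-- Reassigning a worker whose index has been received. -/
theorem average_pending_update (job : Fin n → Fin m) (M : Finset (Fin m)) (w : Fin n)
    (hw : job w ∈ M) (hM : Mᶜ.Nonempty) :
    1 + (∑ j' ∈ Mᶜ, pending (Function.update job w j') M) / Mᶜ.card ≤ pending job M := by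
  have hr : (0 : ℝ) < Mᶜ.card := by exact_mod_cast hM.card_pos
  have h : ∀ j' ∈ Mᶜ, pending (Function.update job w j') M =
      pending job M + (loadWeight n Mᶜ.card - 2) + 2 * loadWeight n Mᶜ.card * load job j' := by
    intro j' hj'
    rw [Finset.mem_compl] at hj'
    unfold pending
    rw [stale_update job M w j' hw hj', sum_sq_load_update job M w j' hw hj']
    ring
  rw [Finset.sum_congr rfl h, Finset.sum_add_distrib, Finset.sum_const, ← Finset.mul_sum,
    nsmul_eq_mul]
  have h1 := sum_load_le job Mᶜ
  -- With `r` indices missing, one stale worker fewer is worth `2`, and the squared loads grow in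
  -- mean by at most `1 + 2n/r`. The weight times this growth is at most `1`, so the net drop is at
  -- least `1`.
  have h2 : loadWeight n Mᶜ.card * (Mᶜ.card + 2 * n) ≤ Mᶜ.card := by
    unfold loadWeight
    rw [div_mul_eq_mul_div, div_le_iff₀ (by positivity)]
    nlinarith [(Nat.cast_nonneg n : (0 : ℝ) ≤ n)]
  have h3 := loadWeight_nonneg n Mᶜ.card
  rw [← le_sub_iff_add_le', div_le_iff₀ hr]
  nlinarith [mul_le_mul_of_nonneg_left h1 h3]

/-- All workers on a newly received `j` become stale, at cost `2 load`. The removed square and the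
removed harmonic term pay for this by `2 a ≤ κ a² + κ⁻¹`. -/
theorem pending_insert_le (job : Fin n → Fin m) (M : Finset (Fin m)) (j : Fin m) :
    pending job (insert j M) ≤ pending job M := by
  by_cases hj : j ∈ M
  · rw [Finset.insert_eq_of_mem hj]
  have hj' : j ∈ Mᶜ := Finset.mem_compl.mpr hj
  have hcard : Mᶜ.card = (insert j M)ᶜ.card + 1 := by
    rw [Finset.compl_insert, Finset.card_erase_add_one hj']
  unfold pending stale
  rw [hcard, Finset.sum_range_succ, Finset.sum_insert hj,
    ← Finset.add_sum_erase _ (fun j => load job j ^ 2) hj', ← Finset.compl_insert]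
  set r := (insert j M)ᶜ.card
  have h1 := loadWeight_mono n r
  have h2 : 0 ≤ ∑ j ∈ (insert j M)ᶜ, load job j ^ 2 := by positivity
  have h3 : 2 * load job j ≤ 2 * n / ((r : ℝ) + 1) + 2 + loadWeight n (r + 1) * load job j ^ 2 := by
    have hr : (0 : ℝ) < (r : ℝ) + 1 := by positivity
    have hk : 0 < loadWeight n (r + 1) := by
      unfold loadWeight
      push_cast
      positivity
    -- The weight is chosen as the reciprocal of the harmonic term, which makes the inequality a
    -- perfect square.
    have hk' : loadWeight n (r + 1) * (2 * n / ((r : ℝ) + 1) + 2) = 1 := by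
      unfold loadWeight
      push_cast
      field_simp
    have := sq_nonneg (loadWeight n (r + 1) * load job j - 1)
    rw [← mul_le_mul_iff_right₀ hk]
    nlinarith
  nlinarith [mul_le_mul_of_nonneg_right h1 h2]

/-- After the last gradient no worker is reassigned, but `pending` still counts all `n` workers as
stale. The term `i = 0` of the harmonic sum, `2n + 2`, covers this and the reception itself. -/
theorem one_add_pending_univ_le (job : Fin n → Fin m) (M : Finset (Fin m)) (hM : Mᶜ.Nonempty) :
    1 + pending job Finset.univ ≤ pending job M := by
  obtain ⟨r, hr⟩ := Nat.exists_eq_succ_of_ne_zero hM.card_pos.ne'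
  have h1 : pending job Finset.univ = 2 * n := by
    simp [pending, stale, sum_load]
  rw [h1]
  unfold pending
  have h2 := stale_nonneg job M
  have h3 := loadWeight_nonneg n Mᶜ.card
  have h4 : 0 ≤ loadWeight n Mᶜ.card * ∑ j ∈ Mᶜ, load job j ^ 2 := by positivity
  have h5 : 0 ≤ ∑ k ∈ Finset.range r, (2 * (n : ℝ) / (((k + 1 : ℕ) : ℝ) + 1) + 2) := by positivity
  have h6 : ∑ i ∈ Finset.range Mᶜ.card, (2 * (n : ℝ) / ((i : ℝ) + 1) + 2) =
      ∑ k ∈ Finset.range r, (2 * (n : ℝ) / (((k + 1 : ℕ) : ℝ) + 1) + 2) + (2 * n + 2) := by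
    rw [hr, Finset.sum_range_succ']
    simp
  linarith

/-- Received plus pending is a supermartingale: inserting the index does not raise `pending`, and
the uniform reassignment then lowers it by at least one in mean. Nothing is used about which worker
arrives. -/
theorem expect_gradStep_le (env : Environment n m τ) (F : Fin m → EuclideanSpace ℝ (Fin d) → ℝ)
    (x : EuclideanSpace ℝ (Fin d)) (s : GradCall n m d) :
    expect (gradStep env F x s) (fun s' => ENNReal.ofReal (s'.hist.length + pending s'.job s'.M)) ≤
      ENNReal.ofReal (s.hist.length + pending s.job s.M) := by
  by_cases hM : s.M = Finset.univ
  · rw [gradStep, if_pos hM, expect_pure]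
  have hMc : s.Mᶜ.Nonempty := by
    rwa [Finset.nonempty_iff_ne_empty, Ne, Finset.compl_eq_empty_iff]
  rw [gradStep, if_neg hM]
  dsimp only
  set w := env.next s.hist s.finish with hw
  have hM' : (gradReceive env F x s).M = insert (s.job w) s.M := rfl
  have hlen : ((gradReceive env F x s).hist.length : ℝ) = s.hist.length + 1 := by
    simp [gradReceive]
  have hle := pending_insert_le s.job s.M (s.job w)
  split_ifs with hne
  · rw [expect_map]
    have h := expect_uniformOfFinset _ hne (fun j' => (s.hist.length : ℝ) + 1 +
      pending (Function.update s.job w j') (insert (s.job w) s.M))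
      (fun j' => by have := pending_nonneg (Function.update s.job w j') (insert (s.job w) s.M)
                    positivity)
    have h' : ∀ j', ENNReal.ofReal ((gradAssign env w (gradReceive env F x s) j').hist.length +
        pending (gradAssign env w (gradReceive env F x s) j').job
          (gradAssign env w (gradReceive env F x s) j').M) =
        ENNReal.ofReal ((s.hist.length : ℝ) + 1 +
          pending (Function.update s.job w j') (insert (s.job w) s.M)) := by
      intro j'
      rw [← hlen]
      rfl
    simp_rw [h']
    rw [h]
    refine ENNReal.ofReal_le_ofReal ?_
    rw [hM'] at hne ⊢
    have h1 := average_pending_update s.job (insert (s.job w) s.M) w (Finset.mem_insert_self _ _)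
      hne
    have hr : (0 : ℝ) < (insert (s.job w) s.M)ᶜ.card := by exact_mod_cast hne.card_pos
    rw [Finset.sum_add_distrib, Finset.sum_const, nsmul_eq_mul, add_div,
      mul_div_cancel_left₀ _ hr.ne']
    linarith
  · rw [expect_pure]
    have hu : insert (s.job w) s.M = Finset.univ := by
      rw [hM'] at hne
      rwa [Finset.not_nonempty_iff_eq_empty, Finset.compl_eq_empty_iff] at hne
    refine ENNReal.ofReal_le_ofReal ?_
    rw [hlen, hM', hu, show (gradReceive env F x s).job = s.job from rfl]
    linarith [one_add_pending_univ_le s.job s.M hMc]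

theorem expect_gradLoop_length_le (env : Environment n m τ)
    (F : Fin m → EuclideanSpace ℝ (Fin d) → ℝ) (x : EuclideanSpace ℝ (Fin d)) (N : ℕ)
    (s : GradCall n m d) :
    expect (gradLoop env F x N s) (fun s' => (s'.hist.length : ℝ≥0∞)) ≤
      ENNReal.ofReal (s.hist.length + pending s.job s.M) := by
  induction N generalizing s with
  | zero =>
    rw [gradLoop, expect_pure, ← ENNReal.ofReal_natCast]
    exact ENNReal.ofReal_le_ofReal (le_add_of_nonneg_right (pending_nonneg _ _))
  | succ N ih =>
    rw [gradLoop, expect_bind]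
    exact (expect_mono _ ih).trans (expect_gradStep_le env F x s)

/-! ### The mean of `pending` over the initial assignment -/

theorem sum_sq_load (job : Fin n → Fin m) :
    ∑ j, load job j ^ 2 = ∑ i, ∑ i', if job i = job i' then 1 else 0 := by
  simp only [load, sq, Finset.sum_mul_sum]
  rw [Finset.sum_comm]
  refine Finset.sum_congr rfl fun i _ => ?_
  rw [Finset.sum_comm]
  refine Finset.sum_congr rfl fun i' _ => ?_
  rw [Finset.sum_eq_single (job i)]
  · simp [eq_comm]
  · intro b _ hb
    simp [hb.symm]
  · simp

/-- Resampling the index of `i'` is a bijection on pairs (assignment, index), and exactly one of the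
`m` new values hits the index of `i`. -/
theorem sum_collision {i i' : Fin n} (h : i ≠ i') :
    (m : ℝ) * ∑ job : Fin n → Fin m, (if job i = job i' then (1 : ℝ) else 0) = (m : ℝ) ^ n := by
  have h1 : ∑ job : Fin n → Fin m, ∑ j' : Fin m,
      (if Function.update job i' j' i = Function.update job i' j' i' then (1 : ℝ) else 0) =
      ∑ job : Fin n → Fin m, ∑ _j : Fin m, (if job i = job i' then (1 : ℝ) else 0) := by
    rw [← Finset.sum_product', ← Finset.sum_product']
    refine Finset.sum_nbij' (fun q => (Function.update q.1 i' q.2, q.1 i'))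
      (fun q => (Function.update q.1 i' q.2, q.1 i')) ?_ ?_ ?_ ?_ ?_ <;> simp
  simp only [Function.update_of_ne h, Function.update_self, Finset.sum_ite_eq, Finset.mem_univ,
    if_true, Finset.sum_const, Finset.card_univ, Fintype.card_fin, Fintype.card_fun, nsmul_eq_mul,
    mul_one, Nat.cast_pow, ← Finset.mul_sum] at h1
  exact h1.symm

variable [NeZero m]

theorem sum_sum_sq_load_le :
    (m : ℝ) * ∑ job : Fin n → Fin m, ∑ j, load job j ^ 2 ≤ (m : ℝ) ^ n * (n * (m + n)) := by
  simp_rw [sum_sq_load]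
  rw [Finset.sum_comm, Finset.mul_sum]
  have hm : (1 : ℝ) ≤ m := by exact_mod_cast NeZero.one_le
  have key : ∀ i : Fin n, (m : ℝ) * ∑ job : Fin n → Fin m, ∑ i',
      (if job i = job i' then (1 : ℝ) else 0) ≤ (m : ℝ) ^ n * (m + n) := by
    intro i
    rw [Finset.sum_comm, Finset.mul_sum]
    have : ∀ i' : Fin n, (m : ℝ) * ∑ job : Fin n → Fin m,
        (if job i = job i' then (1 : ℝ) else 0) ≤
        (m : ℝ) ^ n * ((if i = i' then (m : ℝ) else 0) + 1) := by
      intro i'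
      by_cases h : i = i'
      · subst h
        simp
        nlinarith [pow_nonneg (zero_le_one.trans hm) n]
      · rw [sum_collision h]
        simp [h]
    refine (Finset.sum_le_sum fun i' _ => this i').trans ?_
    rw [← Finset.mul_sum, Finset.sum_add_distrib]
    simp
  refine (Finset.sum_le_sum fun i _ => key i).trans ?_
  simp
  nlinarith

/-- The harmonic sum `2n H_m + 2m` is at most `6m`; the mean weighted squares are at most `n/2 ≤ m`.
-/
theorem average_pending_empty_le (hmn : (n : ℝ) * Real.log n ≤ m) (hn : 0 < n) :
    (∑ job : Fin n → Fin m, pending job ∅) / (m : ℝ) ^ n ≤ 7 * m := by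
  have hm : (1 : ℝ) ≤ m := by exact_mod_cast NeZero.one_le
  have hm0 : (0 : ℝ) < m := by linarith
  have hn' : (0 : ℝ) < n := by exact_mod_cast hn
  -- Split `log m = log n + log (m/n)` and use `log t ≤ t - 1` at `t = m/n`; the rest is `n log n ≤
  -- m`.
  have hlog : (n : ℝ) * (1 + Real.log m) ≤ 2 * m := by
    have h1 := Real.log_le_sub_one_of_pos (div_pos hm0 hn')
    rw [Real.log_div hm0.ne' hn'.ne'] at h1
    have h2 := mul_le_mul_of_nonneg_left h1 hn'.le
    have h3 : (n : ℝ) * (m / n - 1) = m - n := by field_simp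
    nlinarith
  have hharm : ∑ i ∈ Finset.range m, (2 * (n : ℝ) / ((i : ℝ) + 1) + 2) ≤ 6 * m := by
    have h1 := harmonic_le_one_add_log m
    have h2 : ∑ i ∈ Finset.range m, (2 * (n : ℝ) / ((i : ℝ) + 1) + 2) =
        2 * (n * (harmonic m : ℝ)) + 2 * m := by
      rw [Finset.sum_add_distrib, harmonic]
      push_cast
      simp only [Finset.mul_sum, Finset.sum_const, Finset.card_range, nsmul_eq_mul]
      congr 1
      · exact Finset.sum_congr rfl fun i _ => by ring
      · ring
    have h3 := mul_le_mul_of_nonneg_left h1 hn'.le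
    linarith
  have hnm : (n : ℝ) ≤ 2 * m := by
    nlinarith [mul_nonneg hn'.le (Real.log_nonneg hm)]
  have hpow : (0 : ℝ) < (m : ℝ) ^ n := by positivity
  rw [div_le_iff₀ hpow]
  have hpend : ∀ job : Fin n → Fin m, pending job ∅ =
      ∑ i ∈ Finset.range m, (2 * (n : ℝ) / ((i : ℝ) + 1) + 2) +
        loadWeight n m * ∑ j, load job j ^ 2 := by
    intro job
    simp [pending, stale]
  simp_rw [hpend]
  rw [Finset.sum_add_distrib, ← Finset.mul_sum]
  have hsq := sum_sum_sq_load_le (n := n) (m := m)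
  have hw : loadWeight n m * ∑ job : Fin n → Fin m, ∑ j, load job j ^ 2 ≤ (m : ℝ) ^ n * m := by
    unfold loadWeight
    rw [div_mul_eq_mul_div, div_le_iff₀ (by positivity)]
    refine hsq.trans ?_
    nlinarith [mul_nonneg hpow.le (add_pos hn' hm0).le]
  have hc : ∑ _job : Fin n → Fin m, ∑ i ∈ Finset.range m, (2 * (n : ℝ) / ((i : ℝ) + 1) + 2) =
      (m : ℝ) ^ n * ∑ i ∈ Finset.range m, (2 * (n : ℝ) / ((i : ℝ) + 1) + 2) := by
    rw [Finset.sum_const]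
    simp
  rw [hc]
  nlinarith [mul_le_mul_of_nonneg_left hharm hpow.le]

theorem expect_computeGradient_length_le (env : Environment n m τ)
    (F : Fin m → EuclideanSpace ℝ (Fin d) → ℝ) (x : EuclideanSpace ℝ (Fin d))
    (h : List (Event n m)) (t : ℝ≥0∞) (hmn : (n : ℝ) * Real.log n ≤ m) (hn : 0 < n) :
    expect (computeGradient env F x h t) (fun s => (s.hist.length : ℝ≥0∞)) ≤
      h.length + 7 * m := by
  rw [computeGradient, expect_bind]
  refine (expect_mono _ fun s => expect_gradLoop_length_le env F x (n * m) s).trans ?_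
  rw [gradStart, expect_map]
  dsimp only
  rw [expect_uniformOfFintype (fun job : Fin n → Fin m => (h.length : ℝ) + pending job ∅)
    fun job => by
      have := pending_nonneg job ∅
      positivity]
  have h7 : (h.length : ℝ≥0∞) + 7 * m = ENNReal.ofReal (h.length + 7 * m) := by
    rw [ENNReal.ofReal_add (by positivity) (by positivity), ENNReal.ofReal_mul (by norm_num)]
    simp
  rw [h7]
  refine ENNReal.ofReal_le_ofReal ?_
  have hpow : (0 : ℝ) < (m : ℝ) ^ n := by
    have : (0 : ℝ) < m := by exact_mod_cast NeZero.pos m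
    positivity
  have hav := average_pending_empty_le (m := m) hmn hn
  rw [Finset.sum_add_distrib, add_div]
  simp only [Finset.sum_const, Finset.card_univ, Fintype.card_fun, Fintype.card_fin, nsmul_eq_mul,
    Nat.cast_pow]
  rw [mul_div_cancel_left₀ _ hpow.ne']
  linarith

/-- The expected duration of `ComputeGradient`. -/
theorem expect_computeGradient_time_le (env : Environment n m τ)
    (F : Fin m → EuclideanSpace ℝ (Fin d) → ℝ) (x : EuclideanSpace ℝ (Fin d))
    (h : List (Event n m)) (t : ℝ≥0∞) (hmn : (n : ℝ) * Real.log n ≤ m) (hn : 0 < n) :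
    expect (computeGradient env F x h t) (fun s => s.time) ≤
      t + 12 * equilibriumTime (m : ℝ≥0) τ := by
  have key : ∀ j : Fin n, expect (computeGradient env F x h t) (fun s => s.time) ≤
      t + 12 * ((∑ i ∈ Finset.Iic j, (τ i)⁻¹)⁻¹ *
        (((m : ℝ≥0) : ℝ≥0∞) + ((j : ℕ) + 1))) := by
    intro j
    set W := (∑ i ∈ Finset.Iic j, (τ i)⁻¹)⁻¹ with hW
    -- For `W = ∞` the bound is trivial; finiteness of `W` allows `W * h.length` to be cancelled
    -- below.
    by_cases hWtop : W = ∞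
    · have : (12 : ℝ≥0∞) * (∞ * (((m : ℝ≥0) : ℝ≥0∞) + ((j : ℕ) + 1))) = ∞ := by
        rw [ENNReal.top_mul (by simp)]
        simp
      rw [hWtop, this]
      simp
    have h1 : expect (computeGradient env F x h t) (fun s => s.time) + W * h.length ≤
        t + W * ((j : ℕ) + 1 + (h.length + 7 * m)) := by
      calc _ = expect (computeGradient env F x h t) (fun s => s.time + W * h.length) := by
            rw [expect_add, expect_const]
        _ ≤ expect (computeGradient env F x h t)
              (fun s => t + W * ((j : ℕ) + 1) + W * s.hist.length) := by
            refine expect_mono_of_support _ fun s hs => ?_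
            refine (computeGradient_time_le env F x h t j s hs).trans_eq ?_
            ring
        _ = t + W * ((j : ℕ) + 1 + expect (computeGradient env F x h t)
              (fun s => (s.hist.length : ℝ≥0∞))) := by
            rw [expect_add, expect_const, expect_const_mul]
            ring
        _ ≤ _ := by
            gcongr
            exact expect_computeGradient_length_le env F x h t hmn hn
    have h2 : expect (computeGradient env F x h t) (fun s => s.time) ≤
        t + W * ((j : ℕ) + 1 + 7 * m) := by
      refine (ENNReal.add_le_add_iff_right (a := W * h.length) (by finiteness)).mp ?_
      refine h1.trans_eq ?_
      ring
    refine h2.trans ?_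
    gcongr t + ?_
    rw [mul_left_comm]
    gcongr W * ?_
    push_cast
    rw [mul_add, add_comm]
    gcongr
    · norm_num
    · exact le_mul_of_one_le_left' (by norm_num)
  rw [equilibriumTime, ENNReal.mul_iInf_of_ne (by simp) (by simp), ENNReal.add_iInf]
  exact le_iInf key

end

section

variable {n m d : ℕ} {τ : Fin n → ℝ≥0∞}

/-! ### Gradients of the objective -/

theorem gradient_average (F : Fin m → EuclideanSpace ℝ (Fin d) → ℝ)
    (hF : ∀ i, Differentiable ℝ (F i)) (x : EuclideanSpace ℝ (Fin d)) :
    gradient (average F) x = (1 / (m : ℝ)) • ∑ i, gradient (F i) x := by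
  have h : HasFDerivAt (average F) ((1 / (m : ℝ)) • ∑ i, fderiv ℝ (F i) x) x := by
    unfold average
    exact (HasFDerivAt.fun_sum fun i _ => (hF i x).hasFDerivAt).const_mul _
  unfold gradient
  rw [h.fderiv, map_smulₛₗ, map_sum]
  simp

/-- The descent lemma. -/
theorem IsSmoothWith.le_add {L : ℝ} {f : EuclideanSpace ℝ (Fin d) → ℝ} (h : IsSmoothWith L f)
    (x v : EuclideanSpace ℝ (Fin d)) :
    f (x + v) ≤ f x + inner ℝ (gradient f x) v + L / 2 * ‖v‖ ^ 2 := by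
  have hline : ∀ t : ℝ, HasDerivAt (fun t : ℝ => x + t • v) v t := fun t => by
    simpa using ((hasDerivAt_id t).smul_const v).const_add x
  have hder : ∀ t : ℝ, HasDerivAt (fun t : ℝ => f (x + t • v) - t * inner ℝ (gradient f x) v -
      L / 2 * ‖v‖ ^ 2 * t ^ 2)
      (inner ℝ (gradient f (x + t • v)) v - inner ℝ (gradient f x) v - L * ‖v‖ ^ 2 * t) t := by
    intro t
    have h1 := ((h.1 (x + t • v)).hasGradientAt.hasFDerivAt).comp_hasDerivAt t (hline t)
    have h2 := (h1.sub ((hasDerivAt_id t).mul_const (inner ℝ (gradient f x) v))).sub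
      ((hasDerivAt_pow 2 t).const_mul (L / 2 * ‖v‖ ^ 2))
    refine h2.congr_deriv ?_
    simp
    ring
  have hanti := antitoneOn_of_deriv_nonpos (convex_Ici (0 : ℝ))
    (fun t _ => (hder t).continuousAt.continuousWithinAt)
    (fun t _ => (hder t).differentiableAt.differentiableWithinAt)
    (fun t ht => by
      rw [interior_Ici, Set.mem_Ioi] at ht
      rw [(hder t).deriv, ← inner_sub_left]
      have h3 := real_inner_le_norm (gradient f (x + t • v) - gradient f x) v
      have h4 := h.2 (x + t • v) x
      rw [add_sub_cancel_left, norm_smul, Real.norm_of_nonneg ht.le] at h4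
      nlinarith [mul_le_mul_of_nonneg_right h4 (norm_nonneg v)])
  have := hanti (Set.mem_Ici.mpr le_rfl) (Set.mem_Ici.mpr zero_le_one) zero_le_one
  simp only [zero_smul, add_zero, one_smul, zero_mul, one_mul, one_pow, sub_zero, mul_one,
    zero_pow two_ne_zero, mul_zero] at this
  linarith

/-! ### `ComputeGradient` returns the gradient -/

theorem gradLoop_g (env : Environment n m τ) (F : Fin m → EuclideanSpace ℝ (Fin d) → ℝ)
    (x : EuclideanSpace ℝ (Fin d)) (N : ℕ) (s s' : GradCall n m d)
    (hs : s.g = ∑ j ∈ s.M, (1 / (m : ℝ)) • gradient (F j) x)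
    (hs' : s' ∈ (gradLoop env F x N s).support) :
    s'.g = ∑ j ∈ s'.M, (1 / (m : ℝ)) • gradient (F j) x := by
  induction N generalizing s with
  | zero =>
    simp only [gradLoop, PMF.support_pure, Set.mem_singleton_iff] at hs'
    exact hs' ▸ hs
  | succ N ih =>
    rw [gradLoop, PMF.mem_support_bind_iff] at hs'
    obtain ⟨s₁, h₁, h₂⟩ := hs'
    refine ih s₁ ?_ h₂
    by_cases hM : s.M = Finset.univ
    · simp only [gradStep, if_pos hM, PMF.support_pure, Set.mem_singleton_iff] at h₁
      exact h₁ ▸ hs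
    have hr : (gradReceive env F x s).g =
        ∑ j ∈ (gradReceive env F x s).M, (1 / (m : ℝ)) • gradient (F j) x := by
      simp only [gradReceive]
      split_ifs with hj
      · rw [Finset.insert_eq_of_mem hj, hs]
      · rw [Finset.sum_insert hj, hs, add_comm]
    rw [gradStep, if_neg hM] at h₁
    dsimp only at h₁
    split_ifs at h₁ with hne
    · rw [PMF.mem_support_map_iff] at h₁
      obtain ⟨j', -, rfl⟩ := h₁
      exact hr
    · simp only [PMF.support_pure, Set.mem_singleton_iff] at h₁
      exact h₁ ▸ hr

variable [NeZero m]

theorem computeGradient_g (env : Environment n m τ)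
    (F : Fin m → EuclideanSpace ℝ (Fin d) → ℝ) (hF : ∀ i, Differentiable ℝ (F i))
    (x : EuclideanSpace ℝ (Fin d)) (h : List (Event n m)) (t : ℝ≥0∞) (s : GradCall n m d)
    (hs : s ∈ (computeGradient env F x h t).support) : s.g = gradient (average F) x := by
  have hM := computeGradient_complete env F x h t s hs
  rw [computeGradient, PMF.mem_support_bind_iff] at hs
  obtain ⟨s₀, h₀, h₁⟩ := hs
  rw [gradStart, PMF.mem_support_map_iff] at h₀
  obtain ⟨job, -, rfl⟩ := h₀
  rw [gradLoop_g env F x (n * m) _ s (by simp) h₁, hM, gradient_average F hF, Finset.smul_sum]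

/-! ### The variance of `ComputeBatchDifference` -/

/-- Bias-variance decomposition: the deviations from the mean sum to zero, so the cross terms
vanish. -/
theorem average_norm_sq_add_smul (D : Fin m → EuclideanSpace ℝ (Fin d))
    (a : EuclideanSpace ℝ (Fin d)) (c : ℝ) :
    (∑ j, ‖a + c • D j‖ ^ 2) / m = ‖a + c • ((1 / (m : ℝ)) • ∑ j, D j)‖ ^ 2 +
      c ^ 2 * ((1 / (m : ℝ)) * ∑ j, ‖D j - (1 / (m : ℝ)) • ∑ i, D i‖ ^ 2) := by
  have hm : (m : ℝ) ≠ 0 := by exact_mod_cast NeZero.ne m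
  set μ := (1 / (m : ℝ)) • ∑ j, D j with hμ
  have hsum : ∑ j, (D j - μ) = 0 := by
    rw [Finset.sum_sub_distrib, Finset.sum_const, Finset.card_univ, Fintype.card_fin,
      ← Nat.cast_smul_eq_nsmul ℝ, hμ, smul_smul, mul_one_div_cancel hm, one_smul, sub_self]
  have h : ∀ j, ‖a + c • D j‖ ^ 2 =
      ‖a + c • μ‖ ^ 2 + 2 * c * inner ℝ (a + c • μ) (D j - μ) + c ^ 2 * ‖D j - μ‖ ^ 2 := by
    intro j
    have : a + c • D j = (a + c • μ) + c • (D j - μ) := by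
      rw [smul_sub]
      abel
    rw [this, norm_add_sq_real, inner_smul_right, norm_smul, mul_pow, Real.norm_eq_abs, sq_abs]
    ring
  simp_rw [h]
  rw [Finset.sum_add_distrib, Finset.sum_add_distrib, ← Finset.mul_sum, ← inner_sum, hsum,
    inner_zero_right, ← Finset.mul_sum, Finset.sum_const, Finset.card_univ, Fintype.card_fin,
    nsmul_eq_mul]
  field_simp
  ring

/-- Averaging over the whole pending vector makes the induction work: one index is revealed, its
worker gets a fresh one, and the vector is again uniform and independent of what was revealed. The
next worker depends only on history and finishing times, not on pending indices. -/
theorem expect_diffLoop_le (env : Environment n m τ)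
    (F : Fin m → EuclideanSpace ℝ (Fin d) → ℝ) (S : ℕ) (x y v D : EuclideanSpace ℝ (Fin d))
    (hD : D = (1 / (m : ℝ)) • ∑ j, (gradient (F j) x - gradient (F j) y)) (σ : ℝ)
    (hσ : (1 / (m : ℝ)) * ∑ j, ‖gradient (F j) x - gradient (F j) y - D‖ ^ 2 ≤ σ)
    (N : ℕ) (s : Call n m d) :
    (expect (PMF.uniformOfFintype (Fin n → Fin m)) fun job =>
      expect (diffLoop env F S x y N { s with job := job }) fun s' =>
        ENNReal.ofReal (‖s'.g - v‖ ^ 2)) ≤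
      ENNReal.ofReal (‖s.g - v + ((N : ℝ) / S) • D‖ ^ 2 + N / (S : ℝ) ^ 2 * σ) := by
  induction N generalizing s with
  | zero => simp [diffLoop, expect_pure, expect_const]
  | succ N ih =>
    simp only [diffLoop, expect_bind, diffStep, expect_map]
    set w := env.next s.hist s.finish with hw
    have hre := expect_uniform_resample (ι := Fin n) (κ := Fin m) w fun j job =>
      expect (diffLoop env F S x y N
        { hist := Event.arrival w j :: s.hist
          time := s.finish w
          job := job
          finish := Function.update s.finish w
            (s.finish w + env.diffTime (Event.arrival w j :: s.hist) w)
          g := s.g + (1 / (S : ℝ)) • (gradient (F j) x - gradient (F j) y) }) fun s' =>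
        ENNReal.ofReal (‖s'.g - v‖ ^ 2)
    rw [hre]
    have hσ0 : 0 ≤ σ := le_trans (by positivity) hσ
    refine (expect_mono _ fun j => ih
      { hist := Event.arrival w j :: s.hist
        time := s.finish w
        job := s.job
        finish := Function.update s.finish w
          (s.finish w + env.diffTime (Event.arrival w j :: s.hist) w)
        g := s.g + (1 / (S : ℝ)) • (gradient (F j) x - gradient (F j) y) }).trans ?_
    rw [expect_uniformOfFintype _ fun j => by positivity]
    refine ENNReal.ofReal_le_ofReal ?_
    have hm : (m : ℝ) ≠ 0 := by exact_mod_cast NeZero.ne m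
    have hav := average_norm_sq_add_smul (fun j => gradient (F j) x - gradient (F j) y)
      (s.g - v + ((N : ℝ) / S) • D) (1 / (S : ℝ))
    rw [← hD] at hav
    have hg : ∀ j, s.g + (1 / (S : ℝ)) • (gradient (F j) x - gradient (F j) y) - v +
        ((N : ℝ) / S) • D =
        s.g - v + ((N : ℝ) / S) • D + (1 / (S : ℝ)) • (gradient (F j) x - gradient (F j) y) :=
      fun j => by abel
    dsimp only
    simp_rw [hg]
    rw [Finset.sum_add_distrib, add_div, Finset.sum_const, Finset.card_univ,
      Fintype.card_fin, hav, nsmul_eq_mul, mul_div_cancel_left₀ _ hm, add_assoc (s.g - v), ← add_smul]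
    have h1 : (N : ℝ) / S + 1 / S = ((N + 1 : ℕ) : ℝ) / S := by
      push_cast
      ring
    rw [h1, add_assoc]
    gcongr
    have h2 := mul_le_mul_of_nonneg_left hσ (sq_nonneg (1 / (S : ℝ)))
    refine (add_le_add_left h2 _).trans_eq ?_
    push_cast
    ring

/-- The mean squared error of `ComputeBatchDifference`. -/
theorem expect_computeBatchDifference_le (env : Environment n m τ)
    (F : Fin m → EuclideanSpace ℝ (Fin d) → ℝ) (hF : ∀ i, Differentiable ℝ (F i)) {L : ℝ}
    (hvar : HessianVariance L F) (S : ℕ) (hS : 1 ≤ S) (x y v : EuclideanSpace ℝ (Fin d))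
    (h : List (Event n m)) (t : ℝ≥0∞) :
    expect (computeBatchDifference env F S x y h t) (fun r => ENNReal.ofReal (‖r.g - v‖ ^ 2)) ≤
      ENNReal.ofReal (‖gradient (average F) x - gradient (average F) y - v‖ ^ 2 +
        L ^ 2 * ‖x - y‖ ^ 2 / S) := by
  have hS' : (S : ℝ) ≠ 0 := by
    have : S ≠ 0 := by omega
    exact_mod_cast this
  rw [computeBatchDifference, expect_bind, diffStart, expect_map]
  have hD : gradient (average F) x - gradient (average F) y =
      (1 / (m : ℝ)) • ∑ j, (gradient (F j) x - gradient (F j) y) := by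
    rw [gradient_average F hF, gradient_average F hF, Finset.sum_sub_distrib, smul_sub]
  refine (expect_diffLoop_le env F S x y v _ hD _ (hvar x y) S
    { hist := h, time := t, job := 0, finish := fun i => t + env.diffTime h i, g := 0 }).trans ?_
  refine ENNReal.ofReal_le_ofReal (le_of_eq ?_)
  dsimp only
  rw [div_self hS', one_smul, zero_sub, neg_add_eq_sub]
  congr 1
  field_simp

end

section

variable {n m d : ℕ} {τ : Fin n → ℝ≥0∞}

/-! ### Convergence -/

/-- The Lyapunov function of PAGE, together with the gradients of the past iterates. -/
def lyapunov (f : EuclideanSpace ℝ (Fin d) → ℝ) (fstar γ p : ℝ) (k : ℕ) (s : State n m d) : ℝ :=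
  γ / 2 * ∑ i ∈ Finset.range k, ‖gradient f (s.x i)‖ ^ 2 + (f (s.x k) - fstar) +
    γ / (2 * p) * ‖s.g - gradient f (s.x k)‖ ^ 2

/-- The descent lemma along `-γ g`, with the inner product expanded by polarization. -/
theorem IsSmoothWith.gradient_step {L : ℝ} {f : EuclideanSpace ℝ (Fin d) → ℝ}
    (h : IsSmoothWith L f) (x g : EuclideanSpace ℝ (Fin d)) (γ : ℝ) :
    f (x - γ • g) + γ / 2 * ‖gradient f x‖ ^ 2 + γ / 2 * (1 - γ * L) * ‖g‖ ^ 2 ≤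
      f x + γ / 2 * ‖g - gradient f x‖ ^ 2 := by
  have h1 := h.le_add x (-(γ • g))
  rw [← sub_eq_add_neg, inner_neg_right, inner_smul_right, norm_neg, norm_smul, mul_pow,
    Real.norm_eq_abs, sq_abs] at h1
  rw [norm_sub_sq_real, real_inner_comm]
  linarith

/-- With `u = γ L₋` and `v = γ L± √((1 - p)/(pS))`, the stepsize gives `u + v = 1`, and `v² ≤ v`
since `0 ≤ v ≤ 1`. -/
theorem rate_inv_stepsize {Lm Lpm : ℝ} (hLm : 0 ≤ Lm) (hLpm : 0 ≤ Lpm) {p : ℝ≥0} (hp0 : 0 < p)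
    (hp1 : p ≤ 1) {S : ℕ} (hS : 1 ≤ S) {γ : ℝ} (hγ : γ * rate Lm Lpm p S = 1) (hγ0 : 0 < γ) :
    γ * Lm + γ ^ 2 * ((1 - p) * Lpm ^ 2 / (p * S)) ≤ 1 := by
  have hp0' : (0 : ℝ) < p := by exact_mod_cast hp0
  have hp1' : (p : ℝ) ≤ 1 := by exact_mod_cast hp1
  have hS' : (0 : ℝ) < S := by exact_mod_cast hS
  set q : ℝ := (1 - p) / (p * S) with hq
  have hq0 : 0 ≤ q := div_nonneg (by linarith) (by positivity)
  have h1 : γ ^ 2 * ((1 - p) * Lpm ^ 2 / (p * S)) = (γ * (Lpm * √q)) ^ 2 := by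
    rw [mul_pow, mul_pow, Real.sq_sqrt hq0, hq]
    ring
  have h2 : γ * Lm + γ * (Lpm * √q) = 1 := by
    rw [← hγ, rate]
    ring
  have h3 : 0 ≤ γ * Lm := by positivity
  have h4 : 0 ≤ γ * (Lpm * √q) := by positivity
  rw [h1]
  nlinarith

theorem lyapunov_update (f : EuclideanSpace ℝ (Fin d) → ℝ) (fstar γ p : ℝ) (k : ℕ)
    (h : List (Event n m)) (t : ℝ≥0∞) (x : ℕ → EuclideanSpace ℝ (Fin d))
    (x' g : EuclideanSpace ℝ (Fin d)) :
    lyapunov f fstar γ p (k + 1)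
        ({ hist := h, time := t, x := Function.update x (k + 1) x', g := g } : State n m d) =
      γ / 2 * ∑ i ∈ Finset.range (k + 1), ‖gradient f (x i)‖ ^ 2 + (f x' - fstar) +
        γ / (2 * p) * ‖g - gradient f x'‖ ^ 2 := by
  unfold lyapunov
  have : ∀ i ∈ Finset.range (k + 1), ‖gradient f (Function.update x (k + 1) x' i)‖ ^ 2 =
      ‖gradient f (x i)‖ ^ 2 := fun i hi => by
    rw [Function.update_of_ne (Finset.mem_range.mp hi).ne]
  simp only [Finset.sum_congr rfl this, Function.update_self]

/-- The last iterate can be included in the sum of squared gradients. -/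
theorem sum_gradient_le_lyapunov {f : EuclideanSpace ℝ (Fin d) → ℝ} {L fstar γ p : ℝ}
    (hsmooth : IsSmoothWith L f) (hfstar : ∀ x, fstar ≤ f x) (hγ : 0 < γ) (hγL : γ * L ≤ 1)
    (hp0 : 0 < p) (hp1 : p ≤ 1) (k : ℕ) (s : State n m d) :
    γ / 2 * ∑ i ∈ Finset.range (k + 1), ‖gradient f (s.x i)‖ ^ 2 ≤ lyapunov f fstar γ p k s := by
  have h1 := hsmooth.gradient_step (s.x k) s.g γ
  -- This next point is hypothetical: bounding `f` below there already controls the gradient at `x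
  -- k`, so `K - 1` iterations suffice for `K` gradients.
  have h2 := hfstar (s.x k - γ • s.g)
  have h3 : 0 ≤ γ / 2 * (1 - γ * L) * ‖s.g‖ ^ 2 :=
    mul_nonneg (mul_nonneg (by positivity) (by linarith)) (by positivity)
  have h4 : γ / 2 * ‖s.g - gradient f (s.x k)‖ ^ 2 ≤
      γ / (2 * p) * ‖s.g - gradient f (s.x k)‖ ^ 2 := by
    gcongr
    linarith
  rw [lyapunov, Finset.sum_range_succ]
  linarith

theorem gradient_eq_zero_of_isSmoothWith_zero {f : EuclideanSpace ℝ (Fin d) → ℝ} {fstar : ℝ}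
    (hsmooth : IsSmoothWith 0 f) (hfstar : ∀ x, fstar ≤ f x) (x : EuclideanSpace ℝ (Fin d)) :
    gradient f x = 0 := by
  by_contra hne
  have hpos : 0 < ‖gradient f x‖ ^ 2 := by
    have := norm_pos_iff.mpr hne
    positivity
  -- The step length makes the linear bound equal to `fstar - 1`, below the infimum.
  have h := hsmooth.le_add x (-((f x - fstar + 1) / ‖gradient f x‖ ^ 2) • gradient f x)
  have h' := hfstar (x + -((f x - fstar + 1) / ‖gradient f x‖ ^ 2) • gradient f x)
  rw [inner_smul_right, real_inner_self_eq_norm_sq, neg_mul, div_mul_cancel₀ _ hpos.ne'] at h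
  linarith

variable [NeZero m]

theorem expect_step_lyapunov_le (env : Environment n m τ)
    (F : Fin m → EuclideanSpace ℝ (Fin d) → ℝ) (hF : ∀ i, Differentiable ℝ (F i))
    {Lm Lpm fstar : ℝ} (hLm : 0 ≤ Lm) (hsmooth : IsSmoothWith Lm (average F))
    (hfstar : ∀ x, fstar ≤ average F x) (hLpm : 0 ≤ Lpm) (hvar : HessianVariance Lpm F)
    {S : ℕ} (hS : 1 ≤ S) {p : ℝ≥0} (hp0 : 0 < p) (hp1 : p ≤ 1)
    {γ : ℝ} (hγ : γ * rate Lm Lpm p S = 1) (hγ0 : 0 < γ) (k : ℕ) (s : State n m d) :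
    expect (step env F γ S p hp1 k s)
        (fun s' => ENNReal.ofReal (lyapunov (average F) fstar γ p (k + 1) s')) ≤
      ENNReal.ofReal (lyapunov (average F) fstar γ p k s) := by
  have hp0' : (0 : ℝ) < p := by exact_mod_cast hp0
  have hp1' : (p : ℝ) ≤ 1 := by exact_mod_cast hp1
  have hS' : (0 : ℝ) < S := by exact_mod_cast hS
  set f := average F with hf
  set x' := s.x k - γ • s.g with hx'
  set a : ℝ := γ / 2 * ∑ i ∈ Finset.range (k + 1), ‖gradient f (s.x i)‖ ^ 2 + (f x' - fstar)
    with ha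
  have ha0 : 0 ≤ a := by
    have := sub_nonneg.mpr (hfstar x')
    positivity
  set b : ℝ := γ / (2 * p) * (‖s.g - gradient f (s.x k)‖ ^ 2 + Lpm ^ 2 * ‖γ • s.g‖ ^ 2 / S) with hb
  have hb0 : 0 ≤ b := by positivity
  have htrue : expect (stepWithCoin env F γ S k s true)
      (fun s' => ENNReal.ofReal (lyapunov f fstar γ p (k + 1) s')) ≤ ENNReal.ofReal a := by
    simp only [stepWithCoin, if_true]
    rw [expect_map]
    refine (expect_mono_of_support _ fun r hr => ?_).trans_eq (expect_const _ _)
    have hg := computeGradient_g env F hF _ _ _ r hr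
    rw [lyapunov_update, hg, sub_self, norm_zero]
    simp [ha, hx', hf]
  have hfalse : expect (stepWithCoin env F γ S k s false)
      (fun s' => ENNReal.ofReal (lyapunov f fstar γ p (k + 1) s')) ≤ ENNReal.ofReal (a + b) := by
    simp only [stepWithCoin, Bool.false_eq_true, if_false]
    rw [expect_map]
    have h1 : ∀ r : Call n m d, ENNReal.ofReal (lyapunov f fstar γ p (k + 1)
        ({ hist := r.hist, time := r.time, x := Function.update s.x (k + 1) x',
           g := s.g + r.g } : State n m d)) = ENNReal.ofReal a + ENNReal.ofReal (γ / (2 * p)) *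
          ENNReal.ofReal (‖r.g - (gradient f x' - s.g)‖ ^ 2) := by
      intro r
      rw [lyapunov_update, ← ENNReal.ofReal_mul (by positivity),
        ← ENNReal.ofReal_add ha0 (by positivity)]
      rw [show s.g + r.g - gradient f x' = r.g - (gradient f x' - s.g) by abel]
    simp_rw [← hx', h1]
    rw [expect_add, expect_const, expect_const_mul, ENNReal.ofReal_add ha0 hb0, hb,
      ENNReal.ofReal_mul (by positivity)]
    gcongr
    have h2 : gradient f x' - gradient f (s.x k) - (gradient f x' - s.g) =
        s.g - gradient f (s.x k) := by abel
    have h3 : ‖x' - s.x k‖ = ‖γ • s.g‖ := by rw [hx', sub_sub_cancel_left, norm_neg]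
    refine (expect_computeBatchDifference_le env F hF hvar S hS x' (s.x k) _ _ _).trans_eq ?_
    rw [← hf, h2, h3]
  rw [step, expect_bind, expect_coin]
  refine (add_le_add (mul_le_mul_right htrue _) (mul_le_mul_right hfalse _)).trans ?_
  have hq : ((1 - p : ℝ≥0) : ℝ≥0∞) = ENNReal.ofReal (1 - (p : ℝ)) := by
    rw [← NNReal.coe_one, ← NNReal.coe_sub hp1, ENNReal.ofReal_coe_nnreal]
  rw [hq, ← ENNReal.ofReal_coe_nnreal (p := p), ← ENNReal.ofReal_mul hp0'.le,
    ← ENNReal.ofReal_mul (by linarith), ← ENNReal.ofReal_add (by positivity)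
      (mul_nonneg (by linarith) (by positivity))]
  refine ENNReal.ofReal_le_ofReal ?_
  have hdesc := hsmooth.gradient_step (s.x k) s.g γ
  rw [← hx'] at hdesc
  have hstep := rate_inv_stepsize hLm hLpm hp0 hp1 hS hγ hγ0
  have hstep' := mul_le_mul_of_nonneg_right hstep
    (show 0 ≤ γ / 2 * ‖s.g‖ ^ 2 by positivity)
  -- The weight `γ/(2p)` loses exactly the `γ/2` of error that descent costs; the last term is
  -- absorbed by the `‖g‖²` gain through `hstep'`.
  have hB : (1 - (p : ℝ)) * b = γ / (2 * p) * ‖s.g - gradient f (s.x k)‖ ^ 2 -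
      γ / 2 * ‖s.g - gradient f (s.x k)‖ ^ 2 +
      γ ^ 2 * ((1 - p) * Lpm ^ 2 / (p * S)) * (γ / 2 * ‖s.g‖ ^ 2) := by
    rw [hb, norm_smul, mul_pow, Real.norm_eq_abs, sq_abs]
    field_simp
  have hsplit : (p : ℝ) * a + (1 - p) * (a + b) = a + (1 - p) * b := by ring
  rw [hsplit, hB, ha, Finset.sum_range_succ, lyapunov]
  linarith

theorem expect_run_lyapunov_le (env : Environment n m τ)
    (F : Fin m → EuclideanSpace ℝ (Fin d) → ℝ) (hF : ∀ i, Differentiable ℝ (F i))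
    {Lm Lpm fstar : ℝ} (hLm : 0 ≤ Lm) (hsmooth : IsSmoothWith Lm (average F))
    (hfstar : ∀ x, fstar ≤ average F x) (hLpm : 0 ≤ Lpm) (hvar : HessianVariance Lpm F)
    {S : ℕ} (hS : 1 ≤ S) {p : ℝ≥0} (hp0 : 0 < p) (hp1 : p ≤ 1) (x₀ : EuclideanSpace ℝ (Fin d))
    {γ : ℝ} (hγ : γ * rate Lm Lpm p S = 1) (hγ0 : 0 < γ) (k : ℕ) :
    expect (run env F x₀ γ S p hp1 k)
        (fun s => ENNReal.ofReal (lyapunov (average F) fstar γ p k s)) ≤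
      ENNReal.ofReal (average F x₀ - fstar) := by
  induction k with
  | zero =>
    rw [run, init, expect_map]
    refine (expect_mono_of_support _ fun r hr => ?_).trans_eq (expect_const _ _)
    rw [lyapunov, computeGradient_g env F hF _ _ _ r hr]
    simp
  | succ k ih =>
    rw [run, expect_bind]
    exact (expect_mono _ fun s => expect_step_lyapunov_le env F hF hLm hsmooth hfstar hLpm hvar hS
      hp0 hp1 hγ hγ0 k s).trans ih

theorem expect_output_le (env : Environment n m τ)
    (F : Fin m → EuclideanSpace ℝ (Fin d) → ℝ) (hF : ∀ i, Differentiable ℝ (F i))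
    {Lm Lpm fstar : ℝ} (hLm : 0 ≤ Lm) (hsmooth : IsSmoothWith Lm (average F))
    (hfstar : ∀ x, fstar ≤ average F x) (hLpm : 0 ≤ Lpm) (hvar : HessianVariance Lpm F)
    {S : ℕ} (hS : 1 ≤ S) {p : ℝ≥0} (hp0 : 0 < p) (hp1 : p ≤ 1) (x₀ : EuclideanSpace ℝ (Fin d))
    {ε γ : ℝ} (hε : 0 < ε) (hγ : γ = (rate Lm Lpm p S)⁻¹) (K : ℕ) (hK0 : 0 < K)
    (hK : pageIterations Lm Lpm (average F x₀ - fstar) ε p S ≤ K) :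
    expect (output env F x₀ γ S p hp1 K hK0)
        (fun x => ENNReal.ofReal (‖gradient (average F) x‖ ^ 2)) ≤ ENNReal.ofReal ε := by
  have hrest : 0 ≤ Lpm * √((1 - (p : ℝ)) / ((p : ℝ) * (S : ℝ))) := by positivity
  have hrate0 : 0 ≤ rate Lm Lpm p S := add_nonneg hLm hrest
  -- If the rate is zero, the Lyapunov argument has no positive stepsize, but then `L₋ = 0` and
  -- every gradient vanishes.
  rcases hrate0.eq_or_lt with hrate | hrate
  · have hLm0 : Lm = 0 := by
      rw [rate] at hrate
      linarith
    subst hLm0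
    refine (expect_mono _ fun x => ?_).trans_eq (expect_const _ _)
    rw [gradient_eq_zero_of_isSmoothWith_zero hsmooth hfstar, norm_zero]
    exact ENNReal.ofReal_le_ofReal (by simpa using hε.le)
  have hγ0 : 0 < γ := hγ ▸ inv_pos.mpr hrate
  have hγ1 : γ * rate Lm Lpm p S = 1 := by rw [hγ, inv_mul_cancel₀ hrate.ne']
  have hγL : γ * Lm ≤ 1 := by
    rw [← hγ1]
    exact mul_le_mul_of_nonneg_left (le_add_of_nonneg_right hrest) hγ0.le
  have hp0' : (0 : ℝ) < p := by exact_mod_cast hp0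
  have hp1' : (p : ℝ) ≤ 1 := by exact_mod_cast hp1
  have hK' : (0 : ℝ) < K := by exact_mod_cast hK0
  rw [output, expect_bind]
  simp_rw [expect_map]
  have hs : ∀ s : State n m d, expect (PMF.uniformOfFinset (Finset.range K)
      (Finset.nonempty_range_iff.mpr hK0.ne')) (fun i =>
        ENNReal.ofReal (‖gradient (average F) (s.x i)‖ ^ 2)) ≤
      ENNReal.ofReal (2 / (γ * K)) *
        ENNReal.ofReal (lyapunov (average F) fstar γ p (K - 1) s) := by
    intro s
    rw [expect_uniformOfFinset _ _ _ (fun i => by positivity),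
      ← ENNReal.ofReal_mul (by positivity), Finset.card_range]
    refine ENNReal.ofReal_le_ofReal ?_
    have h := sum_gradient_le_lyapunov hsmooth hfstar hγ0 hγL hp0' hp1' (K - 1) s
    rw [Nat.sub_add_cancel hK0] at h
    refine le_trans (le_of_eq ?_) (mul_le_mul_of_nonneg_left h (by positivity))
    field_simp
  refine (expect_mono _ hs).trans ?_
  rw [expect_const_mul]
  refine (mul_le_mul_right (expect_run_lyapunov_le env F hF hLm hsmooth hfstar hLpm hvar hS
      hp0 hp1 x₀ hγ1 hγ0 (K - 1)) _).trans ?_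
  rw [← ENNReal.ofReal_mul (by positivity)]
  refine ENNReal.ofReal_le_ofReal ?_
  have hr : rate Lm Lpm p S = 1 / γ := by rw [hγ, one_div, inv_inv]
  rw [pageIterations, hr, div_mul_div_comm, div_le_iff₀ (by positivity)] at hK
  rw [div_mul_eq_mul_div, div_le_iff₀ (by positivity)]
  linarith

/-! ### Time complexity -/

theorem expect_run_time_le (env : Environment n m τ)
    (F : Fin m → EuclideanSpace ℝ (Fin d) → ℝ) (x₀ : EuclideanSpace ℝ (Fin d)) (γ : ℝ) (S : ℕ)
    (p : ℝ≥0) (hp1 : p ≤ 1) (hmn : (n : ℝ) * Real.log n ≤ m) (k : ℕ) :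
    expect (run env F x₀ γ S p hp1 k) State.time ≤
      12 * equilibriumTime (m : ℝ≥0) τ + k * (12 * ((p : ℝ≥0∞) * equilibriumTime (m : ℝ≥0) τ +
        ((1 - p : ℝ≥0) : ℝ≥0∞) * equilibriumTime (S : ℝ≥0) τ)) := by
  have hn : 0 < n := Fin.pos (env.next [] fun _ => 0)
  induction k with
  | zero =>
    rw [run, init, expect_map]
    refine (expect_computeGradient_time_le env F x₀ [] 0 hmn hn).trans_eq ?_
    simp
  | succ k ih =>
    rw [run, expect_bind]
    have hstep : ∀ s : State n m d, expect (step env F γ S p hp1 k s) State.time ≤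
        s.time + 12 * ((p : ℝ≥0∞) * equilibriumTime (m : ℝ≥0) τ +
          ((1 - p : ℝ≥0) : ℝ≥0∞) * equilibriumTime (S : ℝ≥0) τ) := by
      intro s
      have htrue : expect (stepWithCoin env F γ S k s true) State.time ≤
          s.time + 12 * equilibriumTime (m : ℝ≥0) τ := by
        simp only [stepWithCoin, if_true]
        rw [expect_map]
        exact expect_computeGradient_time_le env F _ _ _ hmn hn
      have hfalse : expect (stepWithCoin env F γ S k s false) State.time ≤
          s.time + 12 * equilibriumTime (S : ℝ≥0) τ := by
        simp only [stepWithCoin, Bool.false_eq_true, if_false]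
        rw [expect_map]
        refine (expect_mono_of_support _ fun r hr =>
          computeBatchDifference_time_le env F S _ _ _ _ r hr).trans ?_
        rw [expect_const]
        gcongr
        norm_num
      rw [step, expect_bind, expect_coin]
      refine (add_le_add (mul_le_mul_right htrue _) (mul_le_mul_right hfalse _)).trans_eq ?_
      have hone := coe_add_coe_one_sub p hp1
      calc _ = ((p : ℝ≥0∞) + ((1 - p : ℝ≥0) : ℝ≥0∞)) * s.time +
            12 * ((p : ℝ≥0∞) * equilibriumTime (m : ℝ≥0) τ +
              ((1 - p : ℝ≥0) : ℝ≥0∞) * equilibriumTime (S : ℝ≥0) τ) := by ring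
        _ = _ := by rw [hone, one_mul]
    refine (expect_mono _ hstep).trans ?_
    rw [expect_add, expect_const]
    refine (add_le_add_left ih _).trans_eq ?_
    push_cast
    ring

/-- Each iteration costs at most `12` times the mixed equilibrium time, and `12 k ≤ 24 K_PAGE` is
the constant `48 δ⁰/ε` times the rate. -/
theorem expect_run_time_le_timeBound (env : Environment n m τ)
    (F : Fin m → EuclideanSpace ℝ (Fin d) → ℝ) (x₀ : EuclideanSpace ℝ (Fin d)) (γ : ℝ) (S : ℕ)
    (p : ℝ≥0) (hp1 : p ≤ 1) (hmn : (n : ℝ) * Real.log n ≤ m) (Lm Lpm δ₀ ε : ℝ) (k : ℕ)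
    (hk : (k : ℝ) ≤ 2 * pageIterations Lm Lpm δ₀ ε p S) :
    expect (run env F x₀ γ S p hp1 k) State.time ≤ timeBound m τ Lm Lpm δ₀ ε p S := by
  refine (expect_run_time_le env F x₀ γ S p hp1 hmn k).trans ?_
  unfold timeBound
  rw [← mul_assoc]
  gcongr
  have h : (k : ℝ≥0∞) * 12 = ENNReal.ofReal (k * 12) := by
    rw [ENNReal.ofReal_mul (by positivity)]
    simp
  rw [h]
  refine ENNReal.ofReal_le_ofReal ?_
  unfold pageIterations at hk
  calc (k : ℝ) * 12 ≤ 2 * (2 * δ₀ / ε * rate Lm Lpm p S) * 12 := by gcongr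
    _ = _ := by ring

end

end FreyaPage

end

theorem mainTheorem5
    (n m d : ℕ) [NeZero m] (hmn : (n : ℝ) * Real.log n ≤ m)
    (τ : Fin n → ℝ≥0∞) (hτ : Monotone τ) (env : FreyaPage.Environment n m τ)
    (F : Fin m → EuclideanSpace ℝ (Fin d) → ℝ) (hF : ∀ i, Differentiable ℝ (F i))
    (Lm : ℝ) (hLm : 0 ≤ Lm) (hsmooth : FreyaPage.IsSmoothWith Lm (FreyaPage.average F))
    (fstar : ℝ) (hfstar : ∀ x, fstar ≤ FreyaPage.average F x)
    (hLp : ∃ Lp : ℝ, 0 ≤ Lp ∧ FreyaPage.MeanSquaredSmooth Lp F)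
    (Lpm : ℝ) (hLpm : 0 ≤ Lpm) (hvar : FreyaPage.HessianVariance Lpm F)
    (S : ℕ) (hS : 1 ≤ S) (p : ℝ≥0) (hp0 : 0 < p) (hp1 : p ≤ 1)
    (x₀ : EuclideanSpace ℝ (Fin d)) (δ₀ : ℝ) (hδ₀ : δ₀ = FreyaPage.average F x₀ - fstar)
    (ε : ℝ) (hε : 0 < ε)
    (γ : ℝ) (hγ : γ = (FreyaPage.rate Lm Lpm p S)⁻¹)
    (K : ℕ) (hK0 : 0 < K)
    (hK : K = max 1 ⌈FreyaPage.pageIterations Lm Lpm δ₀ ε p S⌉₊) :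
    -- `x̂ᴷ` is an `ε`-stationary point,
    FreyaPage.expect (FreyaPage.output env F x₀ γ S p hp1 K hK0)
        (fun x => ENNReal.ofReal (‖gradient (FreyaPage.average F) x‖ ^ 2)) ≤ ENNReal.ofReal ε ∧
    -- the time at which it is available is at most the bound in expectation,
    FreyaPage.expect (FreyaPage.run env F x₀ γ S p hp1 (K - 1)) FreyaPage.State.time ≤
        FreyaPage.timeBound m τ Lm Lpm δ₀ ε p S ∧
    -- and so is the time of all `K` complete iterations, as soon as `K_PAGE ≥ 1/2`.
    (1 / 2 ≤ FreyaPage.pageIterations Lm Lpm δ₀ ε p S →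
      FreyaPage.expect (FreyaPage.run env F x₀ γ S p hp1 K) FreyaPage.State.time ≤
        FreyaPage.timeBound m τ Lm Lpm δ₀ ε p S) := by
  subst hδ₀
  have hK1 : FreyaPage.pageIterations Lm Lpm (FreyaPage.average F x₀ - fstar) ε p S ≤ K := by
    rw [hK]
    exact (Nat.le_ceil _).trans (by exact_mod_cast le_max_right _ _)
  have hpage : 0 ≤ FreyaPage.pageIterations Lm Lpm (FreyaPage.average F x₀ - fstar) ε p S := by
    have h1 := sub_nonneg.mpr (hfstar x₀)
    unfold FreyaPage.pageIterations FreyaPage.rate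
    positivity
  have hK2 : (K : ℝ) - 1 ≤
      FreyaPage.pageIterations Lm Lpm (FreyaPage.average F x₀ - fstar) ε p S := by
    rw [hK, Nat.cast_max, sub_le_iff_le_add]
    refine max_le ?_ (Nat.ceil_lt_add_one hpage).le
    push_cast
    linarith
  refine ⟨?_, ?_, fun hhalf => ?_⟩
  · exact FreyaPage.expect_output_le env F hF hLm hsmooth hfstar hLpm hvar hS hp0 hp1 x₀ hε hγ K
      hK0 hK1
  · refine FreyaPage.expect_run_time_le_timeBound env F x₀ γ S p hp1 hmn Lm Lpm _ ε (K - 1) ?_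
    rw [Nat.cast_sub hK0]
    push_cast
    linarith
  · refine FreyaPage.expect_run_time_le_timeBound env F x₀ γ S p hp1 hmn Lm Lpm _ ε K ?_
    -- The goal is `K ≤ 2 K_PAGE`. For `K_PAGE ≤ 1` one has `K = 1`, where `K_PAGE ≥ 1/2` is needed;
    -- beyond that, `K ≤ K_PAGE + 1` suffices.
    rcases le_or_gt (FreyaPage.pageIterations Lm Lpm (FreyaPage.average F x₀ - fstar) ε p S) 1
      with h | h
    · have h1 : K = 1 := by
        rw [hK]
        exact max_eq_left (Nat.ceil_le.mpr (by simpa using h))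
      rw [h1]
      push_cast
      linarith
    · linarith
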